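/- **Model.** There are $J$ goods. Individual $i\in\{1,\dots,n\}$ has a random triple of functions $(Y_i,D_i,S_i)$ of a treatment $w\in\{0,1\}$ and a price vector $p\in\mathbb R^J$: outcome $Y_i(w,p)\in\mathbb R$, demand $D_i(w,p)\in\mathbb R^J$ and supply $S_i(w,p)\in\mathbb R^J$. The triples are i.i.d. draws from a distribution $\Theta$ on a family $\mathcal G$. Put $Z_i=D_i-S_i$, $y(w,p)=\mathbb E[Y_i(w,p)]$ and $z_\pi(p)=\pi\,\mathbb E[Z_i(1,p)]+(1-\pi)\,\mathbb E[Z_i(0,p)]$ with $0<\pi<1$. Assume there are $l,u\in\mathbb R^J$, with box $\mathcal S=\{p: l\le p\le u\}$, such that: 1. For every triple in $\mathcal G$, every $w$, every good $j$ and every $p\in\mathbb R^J$: $Z_{ij}(w,p)\le 0$ if $p_j\ge u_j$, and $Z_{ij}(w,p)\ge 0$ if $p_j<l_j$. For each $w$ and $j$, each of the two inequalities is strict, for all such $p$, on some subset of $\mathcal G$ of positive $\Theta$-measure. 2. Each $Y_i(w,\cdot),D_i(w,\cdot),S_i(w,\cdot)$ is twice continuously differentiable; these functions and their first and second derivatives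 are bounded on a neighbourhood of $\mathcal S$, uniformly over $\mathcal G$. 3. $\|\nabla_p f(p)\|<1$ (operator norm) for all $p\in\mathcal S$, where $f(p)=z_\pi(p)+p$. Let $p^*=p^*_\pi\in\mathcal S$ be the mean-field price, $z_\pi(p^*)=0$. **Experiment.** For each $n$, the treatments $W_i$ are i.i.d. with $\mathbb P(W_i=1)=\pi$, and the perturbations $U_{ij}$ are i.i.d. uniform on $\{-h_n,h_n\}$, with $h_n=cn^{-\alpha}$, $c>0$, $\tfrac14<\alpha<\tfrac12$; triples, treatments and perturbations are independent. The market price $\tilde P$ is a minimizer over $p\in\mathbb R^J$ of $\big\|\frac1n\sum_i Z_i(W_i,p+U_i)\big\|$ (ties broken arbitrarily). One observes $W_i$, $U_i$, $Y_i=Y_i(W_i,\tilde P+U_i)$ and $Z_i=Z_i(W_i,\tilde P+U_i)$. Let $U,Z$ be the $n\times J$ matrices with rows $U_i,Z_i$, let $\hat\Delta_z=(U^\top U)^{-1}U^\top Z$, and let $\hat\Delta_{y1},\hat\Delta_{y0}\in\mathbb R^J$ be the regressions $(U^\top U)^{-1}U^\top Y$ run only on treated, respectively control, units. With $\widehat{\mathrm{Var}}[X_i]=\frac1n\sum_i(X_i-\bar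 X)^2$ and a $J\times J$ matrix $\Delta$, define $$\hat\sigma_D^2(\Delta)=\widehat{\mathrm{Var}}\Big[\Big(\frac{W_i}{\pi}-\frac{1-W_i}{1-\pi}\Big)\big(Y_i+\hat A_i\big)\Big],$$ $$\hat A_i=-W_i\,\pi\,[\hat\Delta_{y1}-\hat\Delta_{y0}]^\top\Delta^{-1}Z_i+(1-W_i)(1-\pi)[\hat\Delta_{y1}-\hat\Delta_{y0}]^\top\Delta^{-1}Z_i .$$ **Limit.** Let $a=\nabla_p[y(1,p)-y(0,p)]_{p=p^*}$ and, for a $J\times J$ matrix $H$, $$\sigma_D^2(H)=\pi(1-\pi)\,\mathbb E[R_i^2]+\mathrm{Var}[T_i],$$ $$R_i=\frac{Y_i(1,p^*)}{\pi}+\frac{Y_i(0,p^*)}{1-\pi}-a^\top H^{-1}\big(Z_i(1,p^*)-Z_i(0,p^*)\big),$$ $$T_i=Y_i(1,p^*)-Y_i(0,p^*)-a^\top H^{-1}\big(\pi Z_i(1,p^*)+(1-\pi)Z_i(0,p^*)\big).$$ **Proposition.** Let $H$ be the Jacobian of $z_\pi$ at $p^*$, $H_{kj}=\partial z_{\pi,k}/\partial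 p_j$. As $n\to\infty$, $$\hat\sigma_D^2(\hat\Delta_z^\top)\to_p\sigma_D^2(H)\qquad\text{and}\qquad\hat\sigma_D^2(\hat\Delta_z)\to_p\sigma_D^2(H^\top).$$ That is, the plug-in variance estimator is consistent for $\sigma_D^2$, whichever of the two layouts is used for the matrix of price derivatives of excess demand, as long as it is the same in the estimator and in the limit (the two coincide if $J=1$ or $H$ is symmetric). -/

import Mathlib

open MeasureTheory ProbabilityTheory Filter Topology
open scoped Matrix

noncomputable section

namespace MarketExperiment

/-- Price vectors for `J` goods, with the Euclidean norm. -/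
abbrev Price (J : ℕ) : Type := EuclideanSpace ℝ (Fin J)

/-- The functions of an individual of type `t`: outcome `Y t w p`, demand `D t w p` and supply
`S t w p` under own treatment `w` (`true` means treated) and at the price vector `p`. Potential
outcomes depend on the treatments of other individuals only through the price. Drawing a type from
a distribution on `𝒯` is drawing the triple of random functions. -/
structure Market (J : ℕ) (𝒯 : Type*) [MeasurableSpace 𝒯] where
  Y : 𝒯 → Bool → Price J → ℝ
  D : 𝒯 → Bool → Price J → Price J
  S : 𝒯 → Bool → Price J → Price J
  measurable_Y : ∀ w p, Measurable fun t => Y t w p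
  measurable_D : ∀ w p, Measurable fun t => D t w p
  measurable_S : ∀ w p, Measurable fun t => S t w p

/-- The box `{p : l ≤ p ≤ u}`. -/
def priceBox {J : ℕ} (l u : Fin J → ℝ) : Set (Price J) :=
  {p | ∀ j, l j ≤ p j ∧ p j ≤ u j}

namespace Market

variable {J : ℕ} {𝒯 : Type*} [MeasurableSpace 𝒯]

/-- Individual excess demand. -/
def Z (M : Market J 𝒯) (t : 𝒯) (w : Bool) (p : Price J) : Price J :=
  M.D t w p - M.S t w p

/-- Expected outcome `y(w, p)`. -/
def y (M : Market J 𝒯) (Θ : Measure 𝒯) (w : Bool) (p : Price J) : ℝ := ∫ t, M.Y t w p ∂Θ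

/-- Expected demand `d(w, p)`. -/
def d (M : Market J 𝒯) (Θ : Measure 𝒯) (w : Bool) (p : Price J) : Price J := ∫ t, M.D t w p ∂Θ

/-- Expected supply `s(w, p)`. -/
def s (M : Market J 𝒯) (Θ : Measure 𝒯) (w : Bool) (p : Price J) : Price J := ∫ t, M.S t w p ∂Θ

/-- Expected excess demand when the treatment probability is `π`. -/
def z (M : Market J 𝒯) (Θ : Measure 𝒯) (π : ℝ) (p : Price J) : Price J :=
  π • (M.d Θ true p - M.s Θ true p) + (1 - π) • (M.d Θ false p - M.s Θ false p)

/-- Excess demand for a good is non-positive once its price reaches `u` and non-negative once its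
price is below `l`, strictly so for a set of types of positive probability. -/
structure BoundaryCondition (M : Market J 𝒯) (Θ : Measure 𝒯) (l u : Fin J → ℝ) : Prop where
  upper : ∀ t w p j, u j ≤ p j → M.Z t w p j ≤ 0
  lower : ∀ t w p j, p j < l j → 0 ≤ M.Z t w p j
  upper_strict : ∀ w j, ∃ A : Set 𝒯, MeasurableSet A ∧ 0 < Θ A ∧
    ∀ t ∈ A, ∀ p : Price J, u j ≤ p j → M.Z t w p j < 0
  lower_strict : ∀ w j, ∃ A : Set 𝒯, MeasurableSet A ∧ 0 < Θ A ∧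
    ∀ t ∈ A, ∀ p : Price J, p j < l j → 0 < M.Z t w p j

/-- Outcome, demand and supply are twice continuously differentiable in the price, and they and
their first two derivatives are bounded, by one constant for all types, on a neighbourhood of the
box `{l ≤ p ≤ u}`. -/
structure SmoothBounded (M : Market J 𝒯) (l u : Fin J → ℝ) : Prop where
  contDiff_Y : ∀ t w, ContDiff ℝ 2 (M.Y t w)
  contDiff_D : ∀ t w, ContDiff ℝ 2 (M.D t w)
  contDiff_S : ∀ t w, ContDiff ℝ 2 (M.S t w)
  bounded : ∃ ρ > 0, ∃ C : ℝ, ∀ t w,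
    ∀ p ∈ priceBox (fun j => l j - ρ) (fun j => u j + ρ), ∀ r : ℕ, r ≤ 2 →
      ‖iteratedFDeriv ℝ r (M.Y t w) p‖ ≤ C ∧
      ‖iteratedFDeriv ℝ r (M.D t w) p‖ ≤ C ∧
      ‖iteratedFDeriv ℝ r (M.S t w) p‖ ≤ C

/-- The Jacobian of `z` at `p`, with entry `∂ z_k / ∂ p_j` in row `k` and column `j`. -/
def jacobian (M : Market J 𝒯) (Θ : Measure 𝒯) (π : ℝ) (p : Price J) :
    Matrix (Fin J) (Fin J) ℝ :=
  Matrix.of fun k j => fderiv ℝ (M.z Θ π) p (EuclideanSpace.single j 1) k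

/-- The gradient in the price of `y(1, ·) - y(0, ·)` at `p`. -/
def effectGradient (M : Market J 𝒯) (Θ : Measure 𝒯) (p : Price J) : Fin J → ℝ :=
  fun j => fderiv ℝ (fun q => M.y Θ true q - M.y Θ false q) p (EuclideanSpace.single j 1)

/-- The variable `R` of the asymptotic variance, for a matrix `H` of price responses. -/
def R (M : Market J 𝒯) (Θ : Measure 𝒯) (π : ℝ) (p : Price J) (H : Matrix (Fin J) (Fin J) ℝ)
    (t : 𝒯) : ℝ :=
  M.Y t true p / π + M.Y t false p / (1 - π)
    - M.effectGradient Θ p ⬝ᵥ (H⁻¹ *ᵥ (M.Z t true p - M.Z t false p).ofLp)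

/-- The variable `T` of the asymptotic variance, for a matrix `H` of price responses. -/
def T (M : Market J 𝒯) (Θ : Measure 𝒯) (π : ℝ) (p : Price J) (H : Matrix (Fin J) (Fin J) ℝ)
    (t : 𝒯) : ℝ :=
  M.Y t true p - M.Y t false p
    - M.effectGradient Θ p ⬝ᵥ (H⁻¹ *ᵥ (π • M.Z t true p + (1 - π) • M.Z t false p).ofLp)

/-- `σ_D² = π (1 - π) E[R²] + Var[T]`. -/
def sigmaSq (M : Market J 𝒯) (Θ : Measure 𝒯) (π : ℝ) (p : Price J)
    (H : Matrix (Fin J) (Fin J) ℝ) : ℝ :=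
  π * (1 - π) * (∫ t, (M.R Θ π p H t) ^ 2 ∂Θ) + variance (M.T Θ π p H) Θ

/-- The price faced by individual `i`: market price `p` plus own perturbation, row `i` of `U`. -/
def facedPrice {n : ℕ} (U : Fin n → Fin J → ℝ) (p : Price J) (i : Fin n) : Price J :=
  p + WithLp.toLp 2 (U i)

/-- Average excess demand at market price `p` in the perturbed system. -/
def avgExcess (M : Market J 𝒯) {n : ℕ} (t : Fin n → 𝒯) (w : Fin n → Bool)
    (U : Fin n → Fin J → ℝ) (p : Price J) : Price J :=
  (n : ℝ)⁻¹ • ∑ i, M.Z (t i) (w i) (facedPrice U p i)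

/-- `p` is a market price of the perturbed system: it minimizes the norm of the average excess
demand over all price vectors. -/
def IsMarketPrice (M : Market J 𝒯) {n : ℕ} (t : Fin n → 𝒯) (w : Fin n → Bool)
    (U : Fin n → Fin J → ℝ) (p : Price J) : Prop :=
  ∀ q, ‖M.avgExcess t w U p‖ ≤ ‖M.avgExcess t w U q‖

/-- Realized outcomes. -/
def obsY (M : Market J 𝒯) {n : ℕ} (t : Fin n → 𝒯) (w : Fin n → Bool)
    (U : Fin n → Fin J → ℝ) (p : Price J) : Fin n → ℝ :=
  fun i => M.Y (t i) (w i) (facedPrice U p i)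

/-- Realized excess demands, an `n × J` matrix. -/
def obsZ (M : Market J 𝒯) {n : ℕ} (t : Fin n → 𝒯) (w : Fin n → Bool)
    (U : Fin n → Fin J → ℝ) (p : Price J) : Matrix (Fin n) (Fin J) ℝ :=
  Matrix.of fun i j => M.Z (t i) (w i) (facedPrice U p i) j

end Market

/-- The law of one treatment: `true` with probability `π`. -/
def treatmentLaw (π : ℝ) : Measure Bool :=
  ENNReal.ofReal π • Measure.dirac true + ENNReal.ofReal (1 - π) • Measure.dirac false

/-- The law of one perturbation vector: independent coordinates, uniform on `{-h, h}`. -/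
def perturbationLaw (J : ℕ) (h : ℝ) : Measure (Fin J → ℝ) :=
  Measure.pi fun _ => (2⁻¹ : ENNReal) • Measure.dirac h + (2⁻¹ : ENNReal) • Measure.dirac (-h)

/-- The joint law of types, treatments and perturbations of `n` individuals. -/
def sampleLaw {𝒯 : Type*} [MeasurableSpace 𝒯] (Θ : Measure 𝒯) (π : ℝ) (J : ℕ) (h : ℝ) (n : ℕ) :
    Measure (Fin n → 𝒯 × Bool × (Fin J → ℝ)) :=
  Measure.pi fun _ => Θ.prod ((treatmentLaw π).prod (perturbationLaw J h))

section Estimators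

variable {J n : ℕ}

/-- Regression without intercept of `V` on the perturbations: `(UᵀU)⁻¹ (UᵀV)`. -/
def slope {ι : Type*} [Fintype ι] (U : Matrix ι (Fin J) ℝ) (V : ι → ℝ) : Fin J → ℝ :=
  (Uᵀ * U)⁻¹ *ᵥ (Uᵀ *ᵥ V)

/-- The regression run only on the individuals with treatment `k`. -/
def armSlope (k : Bool) (w : Fin n → Bool) (U : Matrix (Fin n) (Fin J) ℝ) (V : Fin n → ℝ) :
    Fin J → ℝ :=
  slope (U.submatrix (fun i : {i : Fin n // w i = k} => i.1) id) (fun i => V i.1)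

/-- `(UᵀU)⁻¹ (UᵀZ)`; column `k` is the regression of the excess demand for good `k`. -/
def deltaZ (U Z : Matrix (Fin n) (Fin J) ℝ) : Matrix (Fin J) (Fin J) ℝ :=
  (Uᵀ * U)⁻¹ * (Uᵀ * Z)

/-- Treatment as a number. -/
def ind (b : Bool) : ℝ := if b then 1 else 0

/-- Empirical mean. -/
def empMean (X : Fin n → ℝ) : ℝ := (n : ℝ)⁻¹ * ∑ i, X i

/-- Empirical variance. -/
def empVar (X : Fin n → ℝ) : ℝ := (n : ℝ)⁻¹ * ∑ i, (X i - empMean X) ^ 2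

/-- The adjustment `Â_i`, for an estimate `Δ` of the matrix of price responses. -/
def adjustment (π : ℝ) (w : Fin n → Bool) (U : Matrix (Fin n) (Fin J) ℝ) (Y : Fin n → ℝ)
    (Z : Matrix (Fin n) (Fin J) ℝ) (Δ : Matrix (Fin J) (Fin J) ℝ) (i : Fin n) : ℝ :=
  - ind (w i) * π * ((armSlope true w U Y - armSlope false w U Y) ⬝ᵥ (Δ⁻¹ *ᵥ Z i))
    + (1 - ind (w i)) * (1 - π) *
      ((armSlope true w U Y - armSlope false w U Y) ⬝ᵥ (Δ⁻¹ *ᵥ Z i))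

/-- The plug-in estimator `σ̂_D²`, for an estimate `Δ` of the matrix of price responses. -/
def sigmaHatSq (π : ℝ) (w : Fin n → Bool) (U : Matrix (Fin n) (Fin J) ℝ) (Y : Fin n → ℝ)
    (Z : Matrix (Fin n) (Fin J) ℝ) (Δ : Matrix (Fin J) (Fin J) ℝ) : ℝ :=
  empVar fun i =>
    (ind (w i) / π - (1 - ind (w i)) / (1 - π)) * (Y i + adjustment π w U Y Z Δ i)

end Estimators

/-- Convergence in probability to a constant, along a sequence of probability spaces. -/
def TendstoInProbability {Ω : ℕ → Type*} [∀ n, MeasurableSpace (Ω n)]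
    (P : ∀ n, Measure (Ω n)) (X : ∀ n, Ω n → ℝ) (x : ℝ) : Prop :=
  ∀ ε > 0, Tendsto (fun n => P n {ω | ε ≤ |X n ω - x|}) atTop (𝓝 0)

end MarketExperiment

end

open MarketExperiment

/-! The randomness enters only through empirical means of `φ(type, treatment)` times a monomial of
degree at most two in `U / h`. Since `n h² → ∞`, Chebyshev's inequality shows that such means are
within `o(h)` of their expectations. `AsymptoticSample` records these limits along the filter `whp`
of events of probability tending to one, and everything after that is deterministic analysis along a
filter.

Price: near `p*` the average excess demand differs from minus the identity by a contraction
(`exists_contraction`), and at `p*` it is `O(h)`. It therefore has an exact zero, so the minimizing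
price clears the market exactly. The boundary condition puts every clearing price within `h` of the
box in each coordinate; each cluster point is a zero of `z` in the box, and there is only one
(`tendsto_price`). The contraction then bounds the distance from the price to `p*` by a multiple of
`h` (`exists_norm_price_sub_le`).

Regressions: outcomes and excess demands are expanded to first order at the fixed point `p*`, so the
dependence of the price on the sample is harmless. Correlating with `U / h` and dividing by `h`
removes the level and the price displacement, leaves the mean gradient because the coordinates of `U
/ h` are orthonormal in the limit, and makes the quadratic remainder `O(h)` (`tendsto_cross`).
Column `k` of `deltaZ` estimates the gradient of `z_k`, hence the limit is the transposed Jacobian.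

Variance: for any convergent `Δ` with invertible limit `H`, the summands of the estimator are
uniformly close to i.i.d. bounded variables (`influence`), whose variance equals `sigmaSq` by
algebra valid for every `H` (`mix_sq_sub_sq_mix_influence`). Both layouts are instances of
`tendsto_sigmaHatSq`. -/

noncomputable section

namespace MarketExperiment

/-! ### Convergence in probability as a filter limit, and a weak law with rate. -/

section Probability

variable {Ω : ℕ → Type*} [∀ n, MeasurableSpace (Ω n)]

/-- The filter of events whose probability tends to one along a sequence of probability spaces. -/
def whp (P : ∀ n, Measure (Ω n)) : Filter (Σ n, Ω n) where
  sets := {S | Tendsto (fun n => P n {ω | (⟨n, ω⟩ : Σ n, Ω n) ∉ S}) atTop (𝓝 0)}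
  univ_sets := by simp
  sets_of_superset := by
    intro S S' hS h
    exact tendsto_of_tendsto_of_tendsto_of_le_of_le tendsto_const_nhds hS (fun _ => zero_le)
      (fun n => measure_mono fun ω hω hω' => hω (h hω'))
  inter_sets := by
    intro S S' hS hS'
    have h := hS.add hS'
    rw [add_zero] at h
    refine tendsto_of_tendsto_of_tendsto_of_le_of_le tendsto_const_nhds h (fun _ => zero_le)
      (fun n => (measure_mono ?_).trans (measure_union_le _ _))
    intro ω hω
    by_cases h : (⟨n, ω⟩ : Σ n, Ω n) ∈ S
    · exact Or.inr fun h' => hω ⟨h, h'⟩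
    · exact Or.inl h

variable {P : ∀ n, Measure (Ω n)}

theorem eventually_whp {p : (Σ n, Ω n) → Prop} :
    (∀ᶠ s in whp P, p s) ↔ Tendsto (fun n => P n {ω | ¬ p ⟨n, ω⟩}) atTop (𝓝 0) := Iff.rfl

/-- Thanks to this translation, sums, products and continuous images of limits in probability need
no argument beyond the usual calculus of filters. -/
theorem tendstoInProbability_of_tendsto_whp {X : ∀ n, Ω n → ℝ} {x : ℝ}
    (h : Tendsto (fun s : Σ n, Ω n => X s.1 s.2) (whp P) (𝓝 x)) :
    TendstoInProbability P X x := by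
  intro ε hε
  have h1 := eventually_whp.1 (Metric.tendsto_nhds.1 h ε hε)
  simpa [Real.dist_eq] using h1

theorem tendsto_whp_of_tendstoInProbability {X : ∀ n, Ω n → ℝ} {x : ℝ}
    (h : TendstoInProbability P X x) :
    Tendsto (fun s : Σ n, Ω n => X s.1 s.2) (whp P) (𝓝 x) := by
  refine Metric.tendsto_nhds.2 fun ε hε => eventually_whp.2 ?_
  simpa [Real.dist_eq] using h ε hε

theorem tendsto_fst_whp : Tendsto (fun s : Σ n, Ω n => s.1) (whp P) atTop := by
  intro S hS
  refine tendsto_const_nhds.congr' ?_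
  filter_upwards [hS] with n hn
  have hn' : n ∈ S := hn
  simp [hn']

theorem eventually_whp_of_ae {p : (Σ n, Ω n) → Prop} (h : ∀ n, ∀ᵐ ω ∂(P n), p ⟨n, ω⟩) :
    ∀ᶠ s in whp P, p s := by
  refine eventually_whp.2 (tendsto_const_nhds.congr fun n => ?_)
  exact (ae_iff.1 (h n)).symm

/-- Chebyshev's inequality for the sum of the coordinates: under the product measure its variance is
`n` times that of `g`, which is at most `B ^ 2`. -/
theorem measure_empMean_sub_integral_ge {𝒳 : Type*} [MeasurableSpace 𝒳] {Q : Measure 𝒳}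
    [IsProbabilityMeasure Q] {n : ℕ} (hn : 0 < n) {g : 𝒳 → ℝ} (hg : Measurable g) {B : ℝ}
    (hB : ∀ᵐ x ∂Q, |g x| ≤ B) {ε : ℝ} (hε : 0 < ε) :
    (Measure.pi fun _ : Fin n => Q)
      {x | ε ≤ |empMean (fun i => g (x i)) - ∫ x, g x ∂Q|} ≤
        ENNReal.ofReal (B ^ 2 / (n * ε ^ 2)) := by
  have hn' : (0 : ℝ) < n := by exact_mod_cast hn
  have hB' : ∀ᵐ x ∂Q, g x ∈ Set.Icc (-B) B := hB.mono fun x hx => abs_le.1 hx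
  have hL : MemLp g 2 Q := memLp_of_bounded hB' hg.aestronglyMeasurable 2
  set X : (Fin n → 𝒳) → ℝ := ∑ i : Fin n, fun x => g (x i) with hX
  have hXL : MemLp X 2 (Measure.pi fun _ : Fin n => Q) :=
    memLp_finsetSum' _ fun i _ => hL.comp_measurePreserving (measurePreserving_eval _ i)
  have hmean : ∫ x, X x ∂(Measure.pi fun _ : Fin n => Q) = n * ∫ x, g x ∂Q := by
    simp only [hX, Finset.sum_apply]
    rw [integral_finsetSum]
    · have : ∀ i : Fin n, ∫ x, g (x i) ∂(Measure.pi fun _ : Fin n => Q) = ∫ x, g x ∂Q := by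
        intro i
        have := (measurePreserving_eval (fun _ : Fin n => Q) i).map_eq
        conv_rhs => rw [← this]
        rw [integral_map (measurable_pi_apply i).aemeasurable hg.aestronglyMeasurable]
      simp [this]
    · intro i _
      exact (hL.comp_measurePreserving (measurePreserving_eval _ i)).integrable (by norm_num)
  have hvar : variance X (Measure.pi fun _ : Fin n => Q) ≤ n * B ^ 2 := by
    rw [hX, variance_sum_pi (X := fun _ : Fin n => g) (fun _ => hL)]
    have : variance g Q ≤ B ^ 2 := by
      have := variance_le_sq_of_bounded hB' hg.aemeasurable
      rwa [show (B - -B) / 2 = B by ring] at this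
    simp only [Finset.sum_const, Finset.card_univ, Fintype.card_fin, nsmul_eq_mul]
    gcongr
  have hc := meas_ge_le_variance_div_sq hXL (mul_pos hn' hε)
  refine (le_of_eq ?_).trans (hc.trans (ENNReal.ofReal_le_ofReal ?_))
  · congr 1
    ext x
    simp only [Set.mem_ofPred_eq, hmean]
    have : X x - n * ∫ x, g x ∂Q = n * (empMean (fun i => g (x i)) - ∫ x, g x ∂Q) := by
      simp only [hX, empMean, Finset.sum_apply]
      field_simp
    rw [this, abs_mul, abs_of_pos hn', mul_le_mul_iff_right₀ hn']
  · rw [div_le_div_iff₀ (by positivity) (by positivity)]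
    have h0 : 0 ≤ (n : ℝ) * ε ^ 2 := by positivity
    nlinarith [mul_le_mul_of_nonneg_right hvar h0]

/-- The weak law of large numbers with rate `r`, for bounded summands that may vary with `n`. -/
theorem tendsto_empMean_sub_integral_div {𝒳 : Type*} [MeasurableSpace 𝒳] {Q : ℕ → Measure 𝒳}
    [∀ n, IsProbabilityMeasure (Q n)] {X : ∀ n, Ω n → Fin n → 𝒳}
    (hX : ∀ n, HasLaw (X n) (Measure.pi fun _ : Fin n => Q n) (P n)) {g : ℕ → 𝒳 → ℝ}
    (hg : ∀ n, Measurable (g n)) {B : ℝ} (hB : ∀ n, ∀ᵐ x ∂(Q n), |g n x| ≤ B) {r : ℕ → ℝ}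
    (hr0 : ∀ᶠ n in atTop, 0 < r n) (hr : Tendsto (fun n : ℕ => n * r n ^ 2) atTop atTop) :
    Tendsto (fun s : Σ n, Ω n =>
      (empMean (fun i => g s.1 (X s.1 s.2 i)) - ∫ x, g s.1 x ∂(Q s.1)) / r s.1)
      (whp P) (𝓝 0) := by
  apply tendsto_whp_of_tendstoInProbability
    (X := fun n ω => (empMean (fun i => g n (X n ω i)) - ∫ x, g n x ∂(Q n)) / r n)
  intro ε hε
  have hlim : Tendsto (fun n : ℕ => ENNReal.ofReal (B ^ 2 / (n * r n ^ 2 * ε ^ 2))) atTop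
      (𝓝 0) := by
    rw [← ENNReal.ofReal_zero]
    refine ENNReal.tendsto_ofReal (Tendsto.div_atTop tendsto_const_nhds ?_)
    exact hr.atTop_mul_const (by positivity)
  refine tendsto_of_tendsto_of_tendsto_of_le_of_le' tendsto_const_nhds hlim
    (Eventually.of_forall fun _ => zero_le) ?_
  filter_upwards [hr0, eventually_gt_atTop 0] with n hrn hn
  have hmeas : MeasurableSet
      {x : Fin n → 𝒳 | r n * ε ≤ |empMean (fun i => g n (x i)) - ∫ x, g n x ∂(Q n)|} := by
    have hgn := hg n
    unfold empMean
    measurability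
  have h := measure_empMean_sub_integral_ge hn (hg n) (hB n) (mul_pos hrn hε)
  rw [← (hX n).map_eq, Measure.map_apply_of_aemeasurable (hX n).aemeasurable hmeas] at h
  rw [show (n : ℝ) * r n ^ 2 * ε ^ 2 = n * (r n * ε) ^ 2 by ring]
  refine (le_of_eq ?_).trans h
  congr 1
  ext ω
  simp only [Set.mem_ofPred_eq, Set.mem_preimage, sub_zero]
  rw [abs_div, abs_of_pos hrn, le_div_iff₀ hrn, mul_comm]

end Probability

/-! ### Moments and supports of the treatment and perturbation laws. -/

section Laws

/-- The uniform law on `{-h, h}`. -/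
def coinLaw (h : ℝ) : Measure ℝ :=
  (2⁻¹ : ENNReal) • Measure.dirac h + (2⁻¹ : ENNReal) • Measure.dirac (-h)

instance (h : ℝ) : IsProbabilityMeasure (coinLaw h) :=
  ⟨by simp [coinLaw, ENNReal.inv_two_add_inv_two]⟩

theorem perturbationLaw_eq_pi (J : ℕ) (h : ℝ) :
    perturbationLaw J h = Measure.pi fun _ => coinLaw h := rfl

instance (J : ℕ) (h : ℝ) : IsProbabilityMeasure (perturbationLaw J h) := by
  rw [perturbationLaw_eq_pi]; infer_instance

theorem isProbabilityMeasure_treatmentLaw {π : ℝ} (h0 : 0 < π) (h1 : π < 1) :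
    IsProbabilityMeasure (treatmentLaw π) := by
  refine ⟨?_⟩
  simp only [treatmentLaw, Measure.add_apply, Measure.smul_apply, measure_univ, smul_eq_mul,
    mul_one]
  rw [← ENNReal.ofReal_add h0.le (by linarith)]
  simp

theorem integral_coinLaw (h : ℝ) (f : ℝ → ℝ) :
    ∫ x, f x ∂(coinLaw h) = (f h + f (-h)) / 2 := by
  rw [coinLaw, integral_add_measure, integral_smul_measure, integral_smul_measure,
    integral_dirac, integral_dirac]
  · simp; ring
  · exact (integrable_dirac (by simp)).smul_measure (by simp)
  · exact (integrable_dirac (by simp)).smul_measure (by simp)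

theorem ae_abs_coinLaw {h : ℝ} (hh : 0 ≤ h) : ∀ᵐ x ∂(coinLaw h), |x| = h := by
  simp [coinLaw, ae_add_measure_iff, abs_of_nonneg hh]

theorem ae_abs_perturbationLaw (J : ℕ) {h : ℝ} (hh : 0 ≤ h) :
    ∀ᵐ u ∂(perturbationLaw J h), ∀ j, |u j| = h := by
  rw [perturbationLaw_eq_pi, ae_all_iff]
  intro j
  exact (measurePreserving_eval (fun _ : Fin J => coinLaw h) j).quasiMeasurePreserving.ae
    (ae_abs_coinLaw hh)

theorem integral_eval_perturbationLaw {J : ℕ} (h : ℝ) (j : Fin J) (f : ℝ → ℝ) (hf : Measurable f) :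
    ∫ u, f (u j) ∂(perturbationLaw J h) = (f h + f (-h)) / 2 := by
  have := (measurePreserving_eval (fun _ : Fin J => coinLaw h) j).map_eq
  rw [← integral_coinLaw, ← this,
    integral_map (measurable_pi_apply j).aemeasurable hf.aestronglyMeasurable]
  rfl

theorem integral_mul_perturbationLaw {J : ℕ} (h : ℝ) (j k : Fin J) :
    ∫ u, u j * u k ∂(perturbationLaw J h) = if j = k then h ^ 2 else 0 := by
  split_ifs with hjk
  · subst hjk
    rw [integral_eval_perturbationLaw h j (fun x => x * x) (by fun_prop)]
    ring
  · have hI := (iIndepFun_pi (μ := fun _ : Fin J => coinLaw h) (X := fun _ x => x)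
      (fun _ => aemeasurable_id)).indepFun hjk
    have := hI.integral_fun_mul_eq_mul_integral (measurable_pi_apply j).aestronglyMeasurable
      (measurable_pi_apply k).aestronglyMeasurable
    rw [perturbationLaw_eq_pi, this, ← perturbationLaw_eq_pi,
      integral_eval_perturbationLaw h j (fun x => x) measurable_id]
    simp

theorem integral_treatmentLaw {π : ℝ} (h0 : 0 < π) (h1 : π < 1) (f : Bool → ℝ) :
    ∫ w, f w ∂(treatmentLaw π) = π * f true + (1 - π) * f false := by
  rw [treatmentLaw, integral_add_measure, integral_smul_measure, integral_smul_measure,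
    integral_dirac, integral_dirac]
  · simp [ENNReal.toReal_ofReal h0.le, ENNReal.toReal_ofReal (sub_nonneg.2 h1.le)]
  · exact (integrable_dirac (by simp)).smul_measure (by simp)
  · exact (integrable_dirac (by simp)).smul_measure (by simp)

end Laws

/-! ### The laws of large numbers satisfied by the sample. -/

section Sample

variable {𝒯 : Type*} [MeasurableSpace 𝒯]

/-- A bounded function of type and treatment, measurable in the type. -/
structure Tame (φ : 𝒯 → Bool → ℝ) : Prop where
  measurable : ∀ w, Measurable fun t => φ t w
  bounded : ∃ B, ∀ t w, |φ t w| ≤ B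

/-- The expectation of a function of type and treatment. -/
def mix (Θ : Measure 𝒯) (π : ℝ) (φ : 𝒯 → Bool → ℝ) : ℝ :=
  π * (∫ t, φ t true ∂Θ) + (1 - π) * ∫ t, φ t false ∂Θ

namespace Tame

variable {φ ψ : 𝒯 → Bool → ℝ}

theorem const (b : Bool → ℝ) : Tame fun (_ : 𝒯) w => b w :=
  ⟨fun _ => measurable_const, max |b true| |b false|, fun _ w => by cases w <;> simp⟩

theorem add (hφ : Tame φ) (hψ : Tame ψ) : Tame fun t w => φ t w + ψ t w := by
  obtain ⟨A, hA⟩ := hφ.bounded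
  obtain ⟨B, hB⟩ := hψ.bounded
  exact ⟨fun w => (hφ.measurable w).add (hψ.measurable w), A + B, fun t w =>
    (abs_add_le _ _).trans (add_le_add (hA t w) (hB t w))⟩

theorem mul (hφ : Tame φ) (hψ : Tame ψ) : Tame fun t w => φ t w * ψ t w := by
  obtain ⟨A, hA⟩ := hφ.bounded
  obtain ⟨B, hB⟩ := hψ.bounded
  refine ⟨fun w => (hφ.measurable w).mul (hψ.measurable w), A * B, fun t w => ?_⟩
  rw [abs_mul]
  exact mul_le_mul (hA t w) (hB t w) (abs_nonneg _) ((abs_nonneg _).trans (hA t w))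

theorem sum {ι : Type*} (s : Finset ι) {φ : ι → 𝒯 → Bool → ℝ} (h : ∀ i, Tame (φ i)) :
    Tame fun t w => ∑ i ∈ s, φ i t w := by
  classical
  induction s using Finset.induction_on with
  | empty => simpa using const fun _ => 0
  | insert i s hi ih => simpa [Finset.sum_insert hi] using (h i).add ih

theorem integrable (hφ : Tame φ) (Θ : Measure 𝒯) [IsFiniteMeasure Θ] (w : Bool) :
    Integrable (fun t => φ t w) Θ := by
  obtain ⟨B, hB⟩ := hφ.bounded
  exact Integrable.of_bound (hφ.measurable w).aestronglyMeasurable B (ae_of_all _ fun t => hB t w)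

end Tame

/-- The laws of large numbers satisfied along `F` by the types, treatments and perturbations of
samples of sizes `N`, where the perturbations have coordinates `± h`. -/
structure AsymptoticSample {J : ℕ} (Θ : Measure 𝒯) (π : ℝ) {ι : Type*} (F : Filter ι) (N : ι → ℕ)
    (h : ι → ℝ) (t : ∀ s, Fin (N s) → 𝒯) (w : ∀ s, Fin (N s) → Bool)
    (U : ∀ s, Fin (N s) → Fin J → ℝ) : Prop where
  size_pos : ∀ᶠ s in F, 0 < N s
  pos : ∀ᶠ s in F, 0 < h s
  tendsto_zero : Tendsto h F (𝓝 0)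
  abs_eq : ∀ᶠ s in F, ∀ i j, |U s i j| = h s
  mean : ∀ φ, Tame φ →
    Tendsto (fun s => (empMean (fun i => φ (t s i) (w s i)) - mix Θ π φ) / h s) F (𝓝 0)
  mean_linear : ∀ φ, Tame φ → ∀ j,
    Tendsto (fun s => empMean (fun i => φ (t s i) (w s i) * (U s i j / h s)) / h s) F (𝓝 0)
  mean_quadratic : ∀ φ, Tame φ → ∀ j k,
    Tendsto (fun s => empMean
      (fun i => φ (t s i) (w s i) * (U s i j / h s * (U s i k / h s)))) F
      (𝓝 (if j = k then mix Θ π φ else 0))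

theorem Tame.measurable_uncurry {φ : 𝒯 → Bool → ℝ} (hφ : Tame φ) :
    Measurable fun x : 𝒯 × Bool => φ x.1 x.2 :=
  measurable_from_prod_countable_left hφ.measurable

theorem integral_treatment_prod (Θ : Measure 𝒯) [IsProbabilityMeasure Θ] {π : ℝ} (h0 : 0 < π)
    (h1 : π < 1) {φ : 𝒯 → Bool → ℝ} (hφ : Tame φ) :
    ∫ x, φ x.1 x.2 ∂(Θ.prod (treatmentLaw π)) = mix Θ π φ := by
  have := isProbabilityMeasure_treatmentLaw h0 h1
  obtain ⟨B, hB⟩ := hφ.bounded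
  have hint : Integrable (fun x : 𝒯 × Bool => φ x.1 x.2) (Θ.prod (treatmentLaw π)) :=
    Integrable.of_bound hφ.measurable_uncurry.aestronglyMeasurable B
      (ae_of_all _ fun x => hB x.1 x.2)
  rw [integral_prod _ hint]
  simp only [integral_treatmentLaw h0 h1]
  rw [integral_add ((hφ.integrable Θ _).const_mul _) ((hφ.integrable Θ _).const_mul _),
    integral_const_mul, integral_const_mul, mix]

/-- Independence of the perturbation from type and treatment, after reassociating the triple
product. -/
theorem integral_sample_mul (Θ : Measure 𝒯) [IsProbabilityMeasure Θ] {π : ℝ} (h0 : 0 < π)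
    (h1 : π < 1) {J : ℕ} (h : ℝ) {φ : 𝒯 → Bool → ℝ} (hφ : Tame φ) (ψ : (Fin J → ℝ) → ℝ) :
    ∫ x, φ x.1 x.2.1 * ψ x.2.2 ∂(Θ.prod ((treatmentLaw π).prod (perturbationLaw J h))) =
      mix Θ π φ * ∫ u, ψ u ∂(perturbationLaw J h) := by
  have := isProbabilityMeasure_treatmentLaw h0 h1
  rw [← integral_treatment_prod Θ h0 h1 hφ, ← integral_prod_mul]
  have := (measurePreserving_prodAssoc Θ (treatmentLaw π) (perturbationLaw J h))
  rw [← this.integral_comp']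
  rfl

theorem ae_abs_mul_le (Θ : Measure 𝒯) [IsProbabilityMeasure Θ] {π : ℝ} (h0 : 0 < π)
    (h1 : π < 1) {J : ℕ} {h : ℝ} (hh : 0 ≤ h) {φ : 𝒯 → Bool → ℝ} {B : ℝ} (hB : ∀ t w, |φ t w| ≤ B)
    {ψ : (Fin J → ℝ) → ℝ} (hψ : ∀ u, (∀ j, |u j| = h) → |ψ u| ≤ 1) :
    ∀ᵐ x ∂(Θ.prod ((treatmentLaw π).prod (perturbationLaw J h))),
      |φ x.1 x.2.1 * ψ x.2.2| ≤ B := by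
  have := isProbabilityMeasure_treatmentLaw h0 h1
  have hq : Measure.QuasiMeasurePreserving (fun x : 𝒯 × Bool × (Fin J → ℝ) => x.2.2)
      (Θ.prod ((treatmentLaw π).prod (perturbationLaw J h))) (perturbationLaw J h) :=
    Measure.quasiMeasurePreserving_snd.comp Measure.quasiMeasurePreserving_snd
  filter_upwards [hq.ae (ae_abs_perturbationLaw J hh)] with x hx
  rw [abs_mul]
  have := mul_le_mul (hB x.1 x.2.1) (hψ _ hx) (abs_nonneg _) ((abs_nonneg _).trans (hB x.1 x.2.1))
  simpa using this

/-- The expression equals `c² n^(1 - 2α)`. It is what allows deviations of means to be divided by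
`h`. -/
theorem tendsto_mul_sq_rpow_atTop {c α : ℝ} (hc : 0 < c) (hα : α < 1 / 2) :
    Tendsto (fun n : ℕ => (n : ℝ) * (c * (n : ℝ) ^ (-α)) ^ 2) atTop atTop := by
  have h1 : Tendsto (fun n : ℕ => c ^ 2 * (n : ℝ) ^ (1 - 2 * α)) atTop atTop :=
    ((tendsto_rpow_atTop (by linarith)).comp tendsto_natCast_atTop_atTop).const_mul_atTop
      (by positivity)
  refine h1.congr' ?_
  filter_upwards [eventually_gt_atTop 0] with n hn
  have hn' : (0 : ℝ) < n := by exact_mod_cast hn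
  rw [mul_pow, ← Real.rpow_natCast ((n : ℝ) ^ (-α)), ← Real.rpow_mul hn'.le,
    show (1 - 2 * α) = 1 + (-α) * (2 : ℕ) by push_cast; ring, Real.rpow_add hn', Real.rpow_one]
  ring

theorem asymptoticSample_of_hasLaw {J : ℕ} (Θ : Measure 𝒯) [IsProbabilityMeasure Θ]
    {π : ℝ} (hπ0 : 0 < π) (hπ1 : π < 1) {c α : ℝ} (hc : 0 < c) (hα0 : 0 < α) (hα1 : α < 1 / 2)
    {Ω : ℕ → Type*} [∀ n, MeasurableSpace (Ω n)] {P : ∀ n, Measure (Ω n)}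
    {t : ∀ n, Ω n → Fin n → 𝒯} {W : ∀ n, Ω n → Fin n → Bool}
    {U : ∀ n, Ω n → Fin n → Fin J → ℝ}
    (hlaw : ∀ n, HasLaw (fun ω i => (t n ω i, W n ω i, U n ω i))
      (sampleLaw Θ π J (c * (n : ℝ) ^ (-α)) n) (P n)) :
    AsymptoticSample Θ π (whp P) (fun s : Σ n, Ω n => s.1) (fun s => c * (s.1 : ℝ) ^ (-α))
      (fun s => t s.1 s.2) (fun s => W s.1 s.2) (fun s => U s.1 s.2) := by
  have := isProbabilityMeasure_treatmentLaw hπ0 hπ1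
  set h : ℕ → ℝ := fun n => c * (n : ℝ) ^ (-α) with hh
  have hpos : ∀ᶠ n in atTop, 0 < h n := by
    filter_upwards [eventually_gt_atTop 0] with n hn
    have hn' : (0 : ℝ) < n := by exact_mod_cast hn
    positivity
  have hnn : ∀ n, 0 ≤ h n := fun n => by positivity
  have hzero : Tendsto h atTop (𝓝 0) := by
    have := ((tendsto_rpow_neg_atTop hα0).comp tendsto_natCast_atTop_atTop).const_mul c
    simpa [hh, Function.comp_def] using this
  have hrate := tendsto_mul_sq_rpow_atTop hc hα1
  have hfst := tendsto_fst_whp (P := P)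
  -- One law covers all three kinds of moments: `ψ` will be `1`, `u j / h` and `u j / h * (u k /
  -- h)`, each bounded by one on the support.
  have key : ∀ φ : 𝒯 → Bool → ℝ, Tame φ → ∀ ψ : ℕ → (Fin J → ℝ) → ℝ, (∀ n, Measurable (ψ n)) →
      (∀ n u, (∀ j, |u j| = h n) → |ψ n u| ≤ 1) →
      Tendsto (fun s : Σ n, Ω n =>
        (empMean (fun i => φ (t s.1 s.2 i) (W s.1 s.2 i) * ψ s.1 (U s.1 s.2 i)) -
          mix Θ π φ * ∫ u, ψ s.1 u ∂(perturbationLaw J (h s.1))) / h s.1) (whp P) (𝓝 0) := by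
    intro φ hφ ψ hψm hψ
    obtain ⟨B, hB⟩ := hφ.bounded
    have := tendsto_empMean_sub_integral_div hlaw
      (g := fun n x => φ x.1 x.2.1 * ψ n x.2.2) (B := B) (r := h) ?_ ?_ hpos hrate
    · simpa only [integral_sample_mul Θ hπ0 hπ1 _ hφ] using this
    · intro n
      exact (hφ.measurable_uncurry.comp (measurable_fst.prodMk measurable_snd.fst)).mul
        ((hψm n).comp measurable_snd.snd)
    · exact fun n => ae_abs_mul_le Θ hπ0 hπ1 (hnn n) hB (hψ n)
  have hdiv : ∀ n (u : Fin J → ℝ), (∀ j, |u j| = h n) → ∀ j, |u j / h n| ≤ 1 := by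
    intro n u hu j
    rw [abs_div, hu, abs_of_nonneg (hnn n)]
    -- The inequality, instead of equality, also covers `n = 0`, where `h n = 0`.
    exact div_self_le_one _
  refine ⟨hfst.eventually_gt_atTop 0, hfst.eventually hpos, hzero.comp hfst, ?_, ?_, ?_, ?_⟩
  · refine eventually_whp_of_ae fun n => ?_
    have hae : ∀ᵐ x ∂(sampleLaw Θ π J (h n) n), ∀ i j, |(x i).2.2 j| = h n := by
      rw [ae_all_iff]
      intro i
      have hq : Measure.QuasiMeasurePreserving
          (fun x : Fin n → 𝒯 × Bool × (Fin J → ℝ) => (x i).2.2)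
          (sampleLaw Θ π J (h n) n) (perturbationLaw J (h n)) :=
        (Measure.quasiMeasurePreserving_snd.comp Measure.quasiMeasurePreserving_snd).comp
          (measurePreserving_eval (fun _ : Fin n =>
            Θ.prod ((treatmentLaw π).prod (perturbationLaw J (h n)))) i).quasiMeasurePreserving
      exact hq.ae (ae_abs_perturbationLaw J (hnn n))
    exact ae_of_ae_map (hlaw n).aemeasurable (by rw [(hlaw n).map_eq]; exact hae)
  · intro φ hφ
    simpa using key φ hφ (fun _ _ => 1) (fun _ => measurable_const) (by simp)
  · intro φ hφ j
    have h1 := key φ hφ (fun n u => u j / h n) (fun n => (measurable_pi_apply j).div_const _)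
      (fun n u hu => hdiv n u hu j)
    have h2 : ∀ n, ∫ u, u j / h n ∂(perturbationLaw J (h n)) = 0 := by
      intro n
      rw [integral_eval_perturbationLaw (h n) j (fun x => x / h n) (by fun_prop)]
      ring
    simpa only [h2, mul_zero, sub_zero] using h1
  · intro φ hφ j k
    have h1 := key φ hφ (fun n u => u j / h n * (u k / h n))
      (fun n => ((measurable_pi_apply j).div_const _).mul ((measurable_pi_apply k).div_const _))
      (fun n u hu => by
        rw [abs_mul]; exact mul_le_one₀ (hdiv n u hu j) (abs_nonneg _) (hdiv n u hu k))
    -- Quadratic moments are needed without a rate, so the division by `h` is undone.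
    have h3 := (h1.mul (hzero.comp hfst)).add_const (if j = k then mix Θ π φ else 0)
    rw [zero_mul, zero_add] at h3
    refine h3.congr' ?_
    filter_upwards [hfst.eventually hpos] with s hs
    have h2 : ∫ u, u j / h s.1 * (u k / h s.1) ∂(perturbationLaw J (h s.1)) =
        if j = k then 1 else 0 := by
      simp_rw [div_mul_div_comm]
      rw [integral_div, integral_mul_perturbationLaw]
      split_ifs
      · field_simp
      · simp
    rw [h2]
    simp only [Function.comp]
    rw [div_mul_cancel₀ _ hs.ne']
    split_ifs <;> simp [hh]

end Sample

/-! ### Uniform first-order expansions in the price. -/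

section Regular

variable {J : ℕ} {𝒯 : Type*} [MeasurableSpace 𝒯]

theorem norm_le_sum_abs (x : Price J) : ‖x‖ ≤ ∑ j, |x j| := by
  have hx : x = ∑ j, x j • EuclideanSpace.single j (1 : ℝ) := by
    ext k
    simp [Finset.sum_apply, Pi.single_apply]
  conv_lhs => rw [hx]
  refine (norm_sum_le _ _).trans (Finset.sum_le_sum fun j _ => ?_)
  simp [norm_smul]

theorem abs_apply_le_norm (x : Price J) (j : Fin J) : |x j| ≤ ‖x‖ := PiLp.norm_apply_le x j

theorem clm_apply_eq_sum (L : Price J →L[ℝ] ℝ) (x : Price J) :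
    L x = ∑ j, L (EuclideanSpace.single j 1) * x j := by
  have hx : x = ∑ j, x j • EuclideanSpace.single j (1 : ℝ) := by
    ext k
    simp [Finset.sum_apply, Pi.single_apply]
  conv_lhs => rw [hx]
  simp [map_sum, mul_comm]

theorem convex_priceBox (l u : Fin J → ℝ) : Convex ℝ (priceBox l u) := by
  intro p hp q hq a b ha hb hab j
  have h1 := hp j
  have h2 := hq j
  have e : b = 1 - a := by linarith
  subst e
  simp only [PiLp.add_apply, PiLp.smul_apply, smul_eq_mul]
  constructor <;> nlinarith

theorem isClosed_priceBox (l u : Fin J → ℝ) : IsClosed (priceBox l u) := by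
  simp only [priceBox, Set.ofPred_forall]
  refine isClosed_iInter fun j => ?_
  have hj : Continuous fun p : Price J => p j := by fun_prop
  exact (isClosed_le continuous_const hj).inter (isClosed_le hj continuous_const)

theorem isCompact_priceBox (l u : Fin J → ℝ) : IsCompact (priceBox l u) := by
  refine Metric.isCompact_of_isClosed_isBounded (isClosed_priceBox l u) ?_
  refine isBounded_iff_forall_norm_le.2 ⟨∑ j, max |l j| |u j|, fun p hp => ?_⟩
  refine (norm_le_sum_abs p).trans (Finset.sum_le_sum fun j _ => ?_)
  exact abs_le_max_abs_abs (hp j).1 (hp j).2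

theorem mem_priceBox_of_norm_sub_le {l u : Fin J → ℝ} {p q : Price J} {a b : ℝ}
    (hp : p ∈ priceBox (fun j => l j - a) (fun j => u j + a)) (hq : ‖q - p‖ ≤ b - a) :
    q ∈ priceBox (fun j => l j - b) (fun j => u j + b) := by
  intro j
  have h1 := abs_le.1 ((abs_apply_le_norm (q - p) j).trans hq)
  have h2 := hp j
  simp only [PiLp.sub_apply] at h1
  constructor <;> simp only at h2 ⊢ <;> linarith [h1.1, h1.2, h2.1, h2.2]

/-- A real function of type, treatment and price which on `B` is bounded and has bounded and
Lipschitz derivatives in the price, by one constant `C` for all types. -/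
structure Regular (F : 𝒯 → Bool → Price J → ℝ) (B : Set (Price J)) (C : ℝ) : Prop where
  measurable : ∀ w p, Measurable fun t => F t w p
  differentiable : ∀ t w, Differentiable ℝ (F t w)
  abs_le : ∀ t w, ∀ p ∈ B, |F t w p| ≤ C
  norm_fderiv_le : ∀ t w, ∀ p ∈ B, ‖fderiv ℝ (F t w) p‖ ≤ C
  norm_fderiv_sub_le : ∀ t w, ∀ p ∈ B, ∀ q ∈ B,
    ‖fderiv ℝ (F t w) p - fderiv ℝ (F t w) q‖ ≤ C * ‖p - q‖

/-- On a convex set, the bound on the second derivative becomes a Lipschitz bound on the first by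
the mean value inequality. -/
theorem regular_of_iteratedFDeriv_le {F : 𝒯 → Bool → Price J → ℝ} {B : Set (Price J)} {C : ℝ}
    (hB : Convex ℝ B) (hm : ∀ w p, Measurable fun t => F t w p)
    (hF : ∀ t w, ContDiff ℝ 2 (F t w))
    (hC : ∀ t w, ∀ p ∈ B, ∀ r : ℕ, r ≤ 2 → ‖iteratedFDeriv ℝ r (F t w) p‖ ≤ C) :
    Regular F B C where
  measurable := hm
  differentiable t w := (hF t w).differentiable (by norm_num)
  abs_le t w p hp := by simpa using hC t w p hp 0 (by norm_num)
  norm_fderiv_le t w p hp := by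
    simpa [norm_iteratedFDeriv_one] using hC t w p hp 1 (by norm_num)
  norm_fderiv_sub_le t w p hp q hq := by
    refine hB.norm_image_sub_le_of_norm_fderiv_le (𝕜 := ℝ) (f := fderiv ℝ (F t w))
      (fun x _ => ?_) (fun x hx => ?_) hq hp
    · exact (((hF t w).fderiv_right (m := 1) (by norm_num)).differentiable (by norm_num)) x
    · have := hC t w x hx 2 le_rfl
      rwa [← norm_iteratedFDeriv_fderiv, norm_iteratedFDeriv_one] at this

namespace Regular

variable {F : 𝒯 → Bool → Price J → ℝ} {B : Set (Price J)} {C : ℝ}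

theorem abs_sub_le (hF : Regular F B C) (hB : Convex ℝ B) (t : 𝒯) (w : Bool) {p q : Price J}
    (hp : p ∈ B) (hq : q ∈ B) : |F t w p - F t w q| ≤ C * ‖p - q‖ :=
  hB.norm_image_sub_le_of_norm_fderiv_le (𝕜 := ℝ) (fun x _ => hF.differentiable t w x)
    (fun x hx => hF.norm_fderiv_le t w x hx) hq hp

/-- On the convex intersection of `B` with the ball of radius `r`, the derivative stays within `C *
r` of its value at `a`. Keeping `p` and `q` separate from `a` serves the contraction estimate; `q =
a` gives the quadratic Taylor remainder. -/
theorem abs_sub_sub_le (hF : Regular F B C) (hC : 0 ≤ C) (hB : Convex ℝ B) (t : 𝒯) (w : Bool)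
    {a p q : Price J} {r : ℝ} (ha : a ∈ B) (hp : p ∈ B) (hq : q ∈ B) (hpr : ‖p - a‖ ≤ r)
    (hqr : ‖q - a‖ ≤ r) :
    |F t w p - F t w q - fderiv ℝ (F t w) a (p - q)| ≤ C * r * ‖p - q‖ := by
  refine (hB.inter (convex_closedBall a r)).norm_image_sub_le_of_norm_fderiv_le' (𝕜 := ℝ)
    (fun x _ => hF.differentiable t w x) (fun x hx => ?_)
    ⟨hq, mem_closedBall_iff_norm.2 hqr⟩ ⟨hp, mem_closedBall_iff_norm.2 hpr⟩
  refine (hF.norm_fderiv_sub_le t w x hx.1 a ha).trans ?_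
  exact mul_le_mul_of_nonneg_left (mem_closedBall_iff_norm.1 hx.2) hC

theorem tame (hF : Regular F B C) {p : Price J} (hp : p ∈ B) : Tame fun t w => F t w p :=
  ⟨fun w => hF.measurable w p, C, fun t w => hF.abs_le t w p hp⟩

/-- Measurability in the type holds because the derivative is the pointwise limit of difference
quotients with step `1 / n`. -/
theorem tame_fderiv (hF : Regular F B C) {p : Price J} (hp : p ∈ B) (v : Price J) :
    Tame fun t w => fderiv ℝ (F t w) p v := by
  refine ⟨fun w => ?_, C * ‖v‖, fun t w => ?_⟩
  · have hlim : ∀ t, Tendsto (fun n : ℕ => (n : ℝ) • (F t w (p + (n : ℝ)⁻¹ • v) - F t w p)) atTop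
        (𝓝 (fderiv ℝ (F t w) p v)) := fun t =>
      ((hF.differentiable t w p).hasFDerivAt.lim_real v).comp tendsto_natCast_atTop_atTop
    refine measurable_of_tendsto_metrizable (fun n => ?_) (tendsto_pi_nhds.2 hlim)
    simp only [smul_eq_mul]
    exact ((hF.measurable w _).sub (hF.measurable w _)).const_mul _
  · exact ((fderiv ℝ (F t w) p).le_opNorm v).trans
      (mul_le_mul_of_nonneg_right (hF.norm_fderiv_le t w p hp) (norm_nonneg _))

/-- The mean of the derivatives. -/
def meanFDeriv (Θ : Measure 𝒯) [IsProbabilityMeasure Θ] (hF : Regular F B C) {p : Price J}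
    (hp : p ∈ B) (w : Bool) : Price J →L[ℝ] ℝ :=
  LinearMap.toContinuousLinearMap
    { toFun := fun v => ∫ t, fderiv ℝ (F t w) p v ∂Θ
      map_add' := fun v v' => by
        simp only [map_add]
        exact integral_add ((hF.tame_fderiv hp v).integrable Θ w)
          ((hF.tame_fderiv hp v').integrable Θ w)
      map_smul' := fun a v => by
        simp only [map_smul, RingHom.id_apply]
        exact integral_smul a _ }

/-- The Taylor remainder is at most `C * ‖q - p‖ ^ 2` for all types at once, so its integral is of
the same order. -/
theorem hasFDerivAt_integral (Θ : Measure 𝒯) [IsProbabilityMeasure Θ] (hF : Regular F B C)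
    (hC : 0 ≤ C) (hB : Convex ℝ B) {p : Price J} (hp : p ∈ B) (hpB : B ∈ 𝓝 p) (w : Bool) :
    HasFDerivAt (fun q => ∫ t, F t w q ∂Θ) (hF.meanFDeriv Θ hp w) p := by
  refine HasFDerivAt.of_isLittleO ?_
  have hsmall : (fun q : Price J => ‖q - p‖ * ‖q - p‖) =o[𝓝 p] fun q => q - p := by
    refine Asymptotics.IsLittleO.of_norm_right ?_
    have h0 : Tendsto (fun q : Price J => ‖q - p‖) (𝓝 p) (𝓝 0) := by
      have : Continuous fun q : Price J => ‖q - p‖ := by fun_prop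
      simpa using this.tendsto p
    simpa using ((Asymptotics.isLittleO_one_iff ℝ).2 h0).mul_isBigO
      (Asymptotics.isBigO_refl (fun q : Price J => ‖q - p‖) (𝓝 p))
  refine Asymptotics.IsBigO.trans_isLittleO (Asymptotics.IsBigO.of_bound C ?_) hsmall
  filter_upwards [hpB] with q hq
  have h1 : (∫ t, F t w q ∂Θ) - (∫ t, F t w p ∂Θ) - hF.meanFDeriv Θ hp w (q - p) =
      ∫ t, (F t w q - F t w p - fderiv ℝ (F t w) p (q - p)) ∂Θ := by
    rw [integral_sub, integral_sub]
    · rfl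
    · exact (hF.tame hq).integrable Θ w
    · exact (hF.tame hp).integrable Θ w
    · exact ((hF.tame hq).integrable Θ w).sub ((hF.tame hp).integrable Θ w)
    · exact (hF.tame_fderiv hp _).integrable Θ w
  rw [h1]
  have h2 := norm_integral_le_of_norm_le_const (μ := Θ) (C := C * ‖q - p‖ * ‖q - p‖)
    (f := fun t => F t w q - F t w p - fderiv ℝ (F t w) p (q - p))
    (ae_of_all _ fun t => hF.abs_sub_sub_le hC hB t w hp hq hp le_rfl (by simp))
  simpa [mul_assoc] using h2

end Regular

end Regular

/-! ### Uniform regularity of outcomes and excess demands. -/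

section MarketRegular

variable {J : ℕ} {𝒯 : Type*} [MeasurableSpace 𝒯] {M : Market J 𝒯} {l u : Fin J → ℝ}

/-- Outcomes and excess demands of all types are regular on the convex set `B`, and demand and
supply are bounded there. -/
structure Market.RegularOn (M : Market J 𝒯) (B : Set (Price J)) (C : ℝ) : Prop where
  nonneg : 0 ≤ C
  convex : Convex ℝ B
  regular_Y : Regular M.Y B C
  regular_Z : ∀ k, Regular (fun t w p => M.Z t w p k) B C
  norm_le : ∀ t w, ∀ p ∈ B, ‖M.D t w p‖ ≤ C ∧ ‖M.S t w p‖ ≤ C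

theorem Market.SmoothBounded.exists_regularOn (h : M.SmoothBounded l u) :
    ∃ ρ > 0, ∃ C : ℝ, M.RegularOn (priceBox (fun j => l j - ρ) (fun j => u j + ρ)) C := by
  obtain ⟨ρ, hρ, C, hC⟩ := h.bounded
  -- The constant is doubled because excess demand is a difference of two functions bounded by `C`.
  have hle : C ≤ |C| + |C| := by linarith [le_abs_self C, abs_nonneg C]
  refine ⟨ρ, hρ, |C| + |C|, by positivity, convex_priceBox _ _, ?_, fun k => ?_,
    fun t w p hp => ?_⟩
  · exact regular_of_iteratedFDeriv_le (convex_priceBox _ _) M.measurable_Y h.contDiff_Y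
      fun t w p hp r hr => (hC t w p hp r hr).1.trans hle
  · refine regular_of_iteratedFDeriv_le (convex_priceBox _ _) (fun w p => ?_) (fun t w => ?_)
      fun t w p hp r hr => ?_
    · have : Measurable fun t => M.Z t w p := (M.measurable_D w p).sub (M.measurable_S w p)
      exact (EuclideanSpace.proj k : Price J →L[ℝ] ℝ).continuous.measurable.comp this
    · exact (EuclideanSpace.proj k : Price J →L[ℝ] ℝ).contDiff.comp
        ((h.contDiff_D t w).sub (h.contDiff_S t w))
    · have hZ : ContDiff ℝ 2 (M.Z t w) := (h.contDiff_D t w).sub (h.contDiff_S t w)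
      have hr2 : (r : WithTop ℕ∞) ≤ 2 := by exact_mod_cast hr
      have h1 := (EuclideanSpace.proj k : Price J →L[ℝ] ℝ).norm_iteratedFDeriv_comp_left
        (hZ.contDiffAt (x := p)) hr2
      have h2 : ‖(EuclideanSpace.proj k : Price J →L[ℝ] ℝ)‖ ≤ 1 :=
        ContinuousLinearMap.opNorm_le_bound _ zero_le_one fun x => by
          simpa using PiLp.norm_apply_le x k
      have h3 : ‖iteratedFDeriv ℝ r (M.Z t w) p‖ ≤ |C| + |C| := by
        have e : M.Z t w = M.D t w - M.S t w := rfl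
        rw [e, iteratedFDeriv_sub_apply ((h.contDiff_D t w).contDiffAt.of_le hr2)
          ((h.contDiff_S t w).contDiffAt.of_le hr2)]
        exact (norm_sub_le _ _).trans (add_le_add ((hC t w p hp r hr).2.1.trans (le_abs_self C))
          ((hC t w p hp r hr).2.2.trans (le_abs_self C)))
      exact h1.trans ((mul_le_of_le_one_left (norm_nonneg _) h2).trans h3)
  · have := hC t w p hp 0 (by norm_num)
    simp only [norm_iteratedFDeriv_zero] at this
    exact ⟨this.2.1.trans hle, this.2.2.trans hle⟩

end MarketRegular

/-! ### Derivatives of the mean-field excess demand. -/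

theorem Market.jacobian_mulVec {J : ℕ} {𝒯 : Type*} [MeasurableSpace 𝒯] (M : Market J 𝒯)
    (Θ : Measure 𝒯) (π : ℝ) (p v : Price J) (k : Fin J) :
    (M.jacobian Θ π p *ᵥ v.ofLp) k = fderiv ℝ (M.z Θ π) p v k := by
  exact (clm_apply_eq_sum
    ((EuclideanSpace.proj k : Price J →L[ℝ] ℝ) ∘L fderiv ℝ (M.z Θ π) p) v).symm

namespace Market.RegularOn

variable {J : ℕ} {𝒯 : Type*} [MeasurableSpace 𝒯] {M : Market J 𝒯} {B : Set (Price J)} {C : ℝ}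
  (Θ : Measure 𝒯) [IsProbabilityMeasure Θ] (π : ℝ)

theorem z_apply (hM : M.RegularOn B C) {p : Price J} (hp : p ∈ B) (k : Fin J) :
    M.z Θ π p k = mix Θ π fun t w => M.Z t w p k := by
  have hD : ∀ w, Integrable (fun t => M.D t w p) Θ := fun w =>
    Integrable.of_bound (M.measurable_D w p).aestronglyMeasurable C
      (ae_of_all _ fun t => (hM.norm_le t w p hp).1)
  have hS : ∀ w, Integrable (fun t => M.S t w p) Θ := fun w =>
    Integrable.of_bound (M.measurable_S w p).aestronglyMeasurable C
      (ae_of_all _ fun t => (hM.norm_le t w p hp).2)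
  have key : ∀ w, (M.d Θ w p - M.s Θ w p) k = ∫ t, M.Z t w p k ∂Θ := by
    intro w
    have h1 : M.d Θ w p - M.s Θ w p = ∫ t, M.Z t w p ∂Θ :=
      (integral_sub (hD w) (hS w)).symm
    rw [h1]
    exact ((EuclideanSpace.proj k : Price J →L[ℝ] ℝ).integral_comp_comm
      ((hD w).sub (hS w))).symm
  simp only [Market.z, PiLp.add_apply, PiLp.smul_apply, smul_eq_mul, key, mix]

theorem hasFDerivAt_z_apply (hM : M.RegularOn B C) {p : Price J} (hp : p ∈ B) (hB : B ∈ 𝓝 p)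
    (k : Fin J) : HasFDerivAt (fun q => M.z Θ π q k)
      (π • (hM.regular_Z k).meanFDeriv Θ hp true +
        (1 - π) • (hM.regular_Z k).meanFDeriv Θ hp false) p := by
  have h := (((hM.regular_Z k).hasFDerivAt_integral Θ hM.nonneg hM.convex hp hB true).const_smul
    π).add (((hM.regular_Z k).hasFDerivAt_integral Θ hM.nonneg hM.convex hp hB false).const_smul
    (1 - π))
  refine h.congr_of_eventuallyEq ?_
  filter_upwards [hB] with q hq
  rw [hM.z_apply Θ π hq]
  rfl

theorem differentiableAt_z (hM : M.RegularOn B C) {p : Price J} (hB : B ∈ 𝓝 p) :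
    DifferentiableAt ℝ (M.z Θ π) p :=
  differentiableAt_euclidean.2 fun k =>
    (hM.hasFDerivAt_z_apply Θ π (mem_of_mem_nhds hB) hB k).differentiableAt

theorem fderiv_z_apply (hM : M.RegularOn B C) {p : Price J} (hB : B ∈ 𝓝 p) (v : Price J)
    (k : Fin J) : fderiv ℝ (M.z Θ π) p v k =
      mix Θ π fun t w => fderiv ℝ (fun q => M.Z t w q k) p v := by
  have h1 := (EuclideanSpace.proj k : Price J →L[ℝ] ℝ).hasFDerivAt.comp p
    (hM.differentiableAt_z Θ π hB).hasFDerivAt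
  have h2 := hM.hasFDerivAt_z_apply Θ π (mem_of_mem_nhds hB) hB k
  exact congrArg (fun L : Price J →L[ℝ] ℝ => L v) (h1.unique h2)

theorem jacobian_apply (hM : M.RegularOn B C) {p : Price J} (hB : B ∈ 𝓝 p) (k j : Fin J) :
    M.jacobian Θ π p k j =
      mix Θ π fun t w => fderiv ℝ (fun q => M.Z t w q k) p (EuclideanSpace.single j 1) :=
  hM.fderiv_z_apply Θ π hB _ k

theorem effectGradient_apply (hM : M.RegularOn B C) {p : Price J} (hB : B ∈ 𝓝 p) (j : Fin J) :
    M.effectGradient Θ p j =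
      (∫ t, fderiv ℝ (M.Y t true) p (EuclideanSpace.single j 1) ∂Θ) -
        ∫ t, fderiv ℝ (M.Y t false) p (EuclideanSpace.single j 1) ∂Θ := by
  have hp := mem_of_mem_nhds hB
  have h := (hM.regular_Y.hasFDerivAt_integral Θ hM.nonneg hM.convex hp hB true).sub
    (hM.regular_Y.hasFDerivAt_integral Θ hM.nonneg hM.convex hp hB false)
  exact congrArg (fun L : Price J →L[ℝ] ℝ => L (EuclideanSpace.single j 1)) h.fderiv

theorem fderiv_z_add_id (hM : M.RegularOn B C) {p : Price J} (hB : B ∈ 𝓝 p) :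
    fderiv ℝ (fun q => M.z Θ π q + q) p =
      fderiv ℝ (M.z Θ π) p + ContinuousLinearMap.id ℝ (Price J) :=
  ((hM.differentiableAt_z Θ π hB).hasFDerivAt.add (hasFDerivAt_id p)).fderiv

/-- A vector in the kernel of the Jacobian is fixed by the derivative of `z + id`, which has norm
less than one. -/
theorem isUnit_det_jacobian (hM : M.RegularOn B C) {p : Price J} (hB : B ∈ 𝓝 p)
    (hc : ‖fderiv ℝ (fun q => M.z Θ π q + q) p‖ < 1) :
    IsUnit (M.jacobian Θ π p).det := by
  rw [← Matrix.isUnit_iff_isUnit_det, ← Matrix.mulVec_injective_iff_isUnit]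
  refine (injective_iff_map_eq_zero (M.jacobian Θ π p).mulVecLin).2 fun v hv => ?_
  have hv' : fderiv ℝ (M.z Θ π) p (WithLp.toLp 2 v) = 0 := by
    ext k
    rw [← Market.jacobian_mulVec]
    exact congrFun hv k
  have h1 : fderiv ℝ (fun q => M.z Θ π q + q) p (WithLp.toLp 2 v) = WithLp.toLp 2 v := by
    rw [hM.fderiv_z_add_id Θ π hB]
    simp [hv']
  by_contra hne
  have hpos : 0 < ‖(WithLp.toLp 2 v : Price J)‖ := by
    rw [norm_pos_iff]
    exact fun h => hne (congrArg WithLp.ofLp h)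
  have h2 := (fderiv ℝ (fun q => M.z Θ π q + q) p).le_opNorm (WithLp.toLp 2 v)
  rw [h1] at h2
  nlinarith

end Market.RegularOn

/-- A map whose derivative has norm less than one on a convex set has at most one fixed point
there. -/
theorem eq_of_norm_fderiv_lt_one {E : Type*} [NormedAddCommGroup E]
    [InnerProductSpace ℝ E] {f : E → E} {s : Set E} (hs : Convex ℝ s)
    (hf : ∀ x ∈ s, DifferentiableAt ℝ f x) (hf' : ∀ x ∈ s, ‖fderiv ℝ f x‖ < 1) {p q : E}
    (hp : p ∈ s) (hq : q ∈ s) (hfp : f p = p) (hfq : f q = q) : p = q := by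
  by_contra hne
  set v := p - q with hv
  have hpos : 0 < ‖v‖ := norm_pos_iff.2 (sub_ne_zero.2 hne)
  have hmem : ∀ x ∈ Set.Icc (0 : ℝ) 1, q + x • v ∈ s := fun x hx =>
    hs.add_smul_sub_mem hq hp hx
  have hd : ∀ x ∈ Set.Icc (0 : ℝ) 1, HasDerivAt (fun x : ℝ => inner ℝ v (f (q + x • v)))
      (inner ℝ v (fderiv ℝ f (q + x • v) v)) x := by
    intro x hx
    have h1 : HasDerivAt (fun x : ℝ => q + x • v) v x := by
      simpa using ((hasDerivAt_id x).smul_const v).const_add q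
    have h2 := ((hf _ (hmem x hx)).hasFDerivAt.comp_hasDerivAt x h1)
    simpa using (hasDerivAt_const x v).inner ℝ h2
  -- Pairing with `v` makes the exact mean value theorem available. The norm bound is then needed at
  -- one intermediate point only, so no uniform constant below one is required.
  obtain ⟨x, hx, hxe⟩ := exists_hasDerivAt_eq_slope (fun x : ℝ => inner ℝ v (f (q + x • v)))
    (fun x => inner ℝ v (fderiv ℝ f (q + x • v) v)) zero_lt_one
    (fun x hx => (hd x hx).continuousAt.continuousWithinAt)
    (fun x hx => hd x (Set.Ioo_subset_Icc_self hx))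
  have hxm := hmem x (Set.Ioo_subset_Icc_self hx)
  simp only [one_smul, zero_smul, add_zero, sub_zero, div_one] at hxe
  rw [← inner_sub_right, show q + v = p by rw [hv]; abel, hfp, hfq, ← hv,
    real_inner_self_eq_norm_sq] at hxe
  have h3 := real_inner_le_norm v (fderiv ℝ f (q + x • v) v)
  have h4 := (fderiv ℝ f (q + x • v)).le_opNorm v
  have h5 := hf' _ hxm
  have h6 : ‖fderiv ℝ f (q + x • v) v‖ < ‖v‖ := h4.trans_lt (by nlinarith)
  nlinarith

/-! ### Algebra of empirical means. -/

section EmpMean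

variable {n : ℕ} {X Y : Fin n → ℝ}

theorem empMean_add (X Y : Fin n → ℝ) :
    empMean (fun i => X i + Y i) = empMean X + empMean Y := by
  simp [empMean, Finset.sum_add_distrib, mul_add]

theorem empMean_sub (X Y : Fin n → ℝ) :
    empMean (fun i => X i - Y i) = empMean X - empMean Y := by
  simp [empMean, Finset.sum_sub_distrib, mul_sub]

theorem empMean_mul_const (X : Fin n → ℝ) (a : ℝ) :
    empMean (fun i => X i * a) = empMean X * a := by
  simp [empMean, Finset.sum_mul, mul_assoc]

theorem empMean_sum {κ : Type*} (s : Finset κ) (X : κ → Fin n → ℝ) :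
    empMean (fun i => ∑ k ∈ s, X k i) = ∑ k ∈ s, empMean (X k) := by
  simp only [empMean]
  rw [Finset.sum_comm, Finset.mul_sum]

theorem abs_empMean_le {a : ℝ} (ha : 0 ≤ a) (h : ∀ i, |X i| ≤ a) : |empMean X| ≤ a := by
  rcases Nat.eq_zero_or_pos n with hn | hn
  · subst hn
    simpa [empMean] using ha
  · have hn' : (0 : ℝ) < n := by exact_mod_cast hn
    rw [empMean, abs_mul, abs_of_pos (inv_pos.2 hn'), inv_mul_le_iff₀ hn']
    refine (Finset.abs_sum_le_sum_abs _ _).trans ((Finset.sum_le_sum fun i _ => h i).trans ?_)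
    simp

theorem exists_ne_zero_of_empMean_ne_zero (h : empMean X ≠ 0) : ∃ i, X i ≠ 0 := by
  by_contra! h'
  exact h (by simp [empMean, h'])

end EmpMean

/-! ### Local contraction and existence of a clearing price. -/

section PriceConvergence

variable {J : ℕ} {𝒯 : Type*} [MeasurableSpace 𝒯] {M : Market J 𝒯}

theorem facedPrice_sub_facedPrice {n : ℕ} (U : Fin n → Fin J → ℝ) (p q : Price J) (i : Fin n) :
    Market.facedPrice U p i - Market.facedPrice U q i = p - q := by
  simp [Market.facedPrice]

theorem norm_facedPrice_sub_le {n : ℕ} {U : Fin n → Fin J → ℝ} {a : ℝ}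
    (hU : ∀ i j, |U i j| = a) (p : Price J) (i : Fin n) :
    ‖Market.facedPrice U p i - p‖ ≤ J * a := by
  refine (norm_le_sum_abs _).trans (le_of_eq ?_)
  simp [Market.facedPrice, hU]

theorem norm_facedPrice_sub_le' {n : ℕ} {U : Fin n → Fin J → ℝ} {a : ℝ}
    (hU : ∀ i j, |U i j| = a) (p q : Price J) (i : Fin n) :
    ‖Market.facedPrice U p i - q‖ ≤ ‖p - q‖ + J * a := by
  have := norm_facedPrice_sub_le hU p i
  rw [show Market.facedPrice U p i - q = (p - q) + (Market.facedPrice U p i - p) by abel]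
  exact (norm_add_le _ _).trans (by linarith)

theorem avgExcess_apply {n : ℕ} (t : Fin n → 𝒯) (w : Fin n → Bool) (U : Fin n → Fin J → ℝ)
    (p : Price J) (k : Fin J) :
    M.avgExcess t w U p k = empMean fun i => M.Z (t i) (w i) (Market.facedPrice U p i) k := by
  simp [Market.avgExcess, empMean]

namespace AsymptoticSample

variable {Θ : Measure 𝒯} {π : ℝ} {ι : Type*} {F : Filter ι} {N : ι → ℕ} {h : ι → ℝ}
  {t : ∀ s, Fin (N s) → 𝒯} {w : ∀ s, Fin (N s) → Bool} {U : ∀ s, Fin (N s) → Fin J → ℝ}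

theorem eventually_lt (hS : AsymptoticSample Θ π F N h t w U) {ε : ℝ} (hε : 0 < ε) :
    ∀ᶠ s in F, h s < ε := hS.tendsto_zero.eventually_lt_const hε

theorem eventually_mul_lt (hS : AsymptoticSample Θ π F N h t w U) (a : ℝ) {ε : ℝ} (hε : 0 < ε) :
    ∀ᶠ s in F, a * h s < ε := by
  have := hS.tendsto_zero.const_mul a
  rw [mul_zero] at this
  exact this.eventually_lt_const hε

theorem tendsto_empMean (hS : AsymptoticSample Θ π F N h t w U) {φ : 𝒯 → Bool → ℝ}
    (hφ : Tame φ) : Tendsto (fun s => empMean fun i => φ (t s i) (w s i)) F (𝓝 (mix Θ π φ)) := by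
  have h1 := ((hS.mean φ hφ).mul hS.tendsto_zero).add_const (mix Θ π φ)
  rw [mul_zero, zero_add] at h1
  refine h1.congr' ?_
  filter_upwards [hS.pos] with s hs
  rw [div_mul_cancel₀ _ hs.ne']
  ring

/-- With high probability, the perturbed average excess demand plus the identity is a contraction
near a point where its mean is one. -/
theorem exists_contraction [IsProbabilityMeasure Θ] (hS : AsymptoticSample Θ π F N h t w U)
    {B : Set (Price J)} {C : ℝ} (hM : M.RegularOn B C) {a : Price J} (hB : B ∈ 𝓝 a)
    (hc : ‖fderiv ℝ (fun q => M.z Θ π q + q) a‖ < 1) :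
    ∃ r > 0, ∃ c : ℝ, 0 ≤ c ∧ c < 1 ∧ ∀ᶠ s in F,
      ∀ p ∈ Metric.closedBall a r, ∀ q ∈ Metric.closedBall a r,
        ‖M.avgExcess (t s) (w s) (U s) p - M.avgExcess (t s) (w s) (U s) q + (p - q)‖ ≤
          c * ‖p - q‖ := by
  set c₀ := ‖fderiv ℝ (fun q => M.z Θ π q + q) a‖ with hc₀
  have hc0 : 0 ≤ c₀ := norm_nonneg _
  obtain ⟨R, hR, hRB⟩ := Metric.nhds_basis_closedBall.mem_iff.1 hB
  set δ := (1 - c₀) / 2 with hδ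
  have hδ0 : 0 < δ := by rw [hδ]; linarith
  have hC := hM.nonneg
  set A : ℝ := J * C + 1 with hA
  have hA0 : 0 < A := by positivity
  -- The first bound keeps faced prices, at distance at most `2 * r` from `a`, inside `B`; the
  -- second makes the summed Taylor errors at most `δ / 2`. The other half of `δ` is left for the
  -- sampling error of the derivatives at `a`.
  set r := min (R / 2) (δ / (4 * A)) with hr
  have hr0 : 0 < r := by positivity
  have hrA : J * (C * (r + r)) ≤ δ / 2 := by
    have h1 : r ≤ δ / (4 * A) := min_le_right _ _
    rw [le_div_iff₀ (by positivity)] at h1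
    nlinarith
  have haB : a ∈ B := mem_of_mem_nhds hB
  set G : Fin J → Fin J → 𝒯 → Bool → ℝ := fun k j t w =>
    fderiv ℝ (fun q => M.Z t w q k) a (EuclideanSpace.single j 1) with hG
  have hGt : ∀ k j, Tame (G k j) := fun k j => (hM.regular_Z k).tame_fderiv haB _
  have herr : Tendsto (fun s => ∑ k, ∑ j, |(empMean fun i => G k j (t s i) (w s i)) -
      mix Θ π (G k j)|) F (𝓝 0) := by
    have : Tendsto (fun s => ∑ k, ∑ j, |(empMean fun i => G k j (t s i) (w s i)) -
        mix Θ π (G k j)|) F (𝓝 (∑ k : Fin J, ∑ j : Fin J, |mix Θ π (G k j) - mix Θ π (G k j)|)) :=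
      tendsto_finsetSum _ fun k _ => tendsto_finsetSum _ fun j _ =>
        ((hS.tendsto_empMean (hGt k j)).sub_const _).abs
    simpa using this
  refine ⟨r, hr0, c₀ + δ, by positivity, by rw [hδ]; linarith, ?_⟩
  filter_upwards [hS.abs_eq, hS.pos, hS.eventually_mul_lt J hr0,
    herr.eventually_lt_const (half_pos hδ0)] with s hU hpos hJ hE p hp q hq
  rw [mem_closedBall_iff_norm] at hp hq
  have hfar : ∀ p : Price J, ‖p - a‖ ≤ r → ∀ i, ‖Market.facedPrice (U s) p i - a‖ ≤ r + r :=
    fun p hp i =>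
    (norm_facedPrice_sub_le' hU p a i).trans (by linarith)
  have hfB : ∀ p : Price J, ‖p - a‖ ≤ r → ∀ i, Market.facedPrice (U s) p i ∈ B := fun p hp i =>
    hRB (mem_closedBall_iff_norm.2 ((hfar p hp i).trans (by
      have : r ≤ R / 2 := min_le_left _ _
      linarith)))
  have hsplit : M.avgExcess (t s) (w s) (U s) p - M.avgExcess (t s) (w s) (U s) q + (p - q) =
      (M.avgExcess (t s) (w s) (U s) p - M.avgExcess (t s) (w s) (U s) q -
        fderiv ℝ (M.z Θ π) a (p - q)) + fderiv ℝ (fun q => M.z Θ π q + q) a (p - q) := by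
    rw [hM.fderiv_z_add_id Θ π hB]
    simp only [_root_.add_apply, ContinuousLinearMap.id_apply]
    abel
  have hcoord : ∀ k, |(M.avgExcess (t s) (w s) (U s) p - M.avgExcess (t s) (w s) (U s) q -
        fderiv ℝ (M.z Θ π) a (p - q)) k| ≤ C * (r + r) * ‖p - q‖ +
        (∑ j, |(empMean fun i => G k j (t s i) (w s i)) - mix Θ π (G k j)|) * ‖p - q‖ := by
    intro k
    have e1 : (M.avgExcess (t s) (w s) (U s) p - M.avgExcess (t s) (w s) (U s) q -
        fderiv ℝ (M.z Θ π) a (p - q)) k =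
        empMean (fun i => M.Z (t s i) (w s i) (Market.facedPrice (U s) p i) k -
          M.Z (t s i) (w s i) (Market.facedPrice (U s) q i) k -
          fderiv ℝ (fun q => M.Z (t s i) (w s i) q k) a (p - q)) +
        ∑ j, ((empMean fun i => G k j (t s i) (w s i)) - mix Θ π (G k j)) * (p - q) j := by
      have e2 : (fun i => fderiv ℝ (fun q => M.Z (t s i) (w s i) q k) a (p - q)) =
          fun i => ∑ j, G k j (t s i) (w s i) * (p - q) j := by
        funext i
        exact clm_apply_eq_sum _ _
      have e3 : fderiv ℝ (M.z Θ π) a (p - q) k = ∑ j, mix Θ π (G k j) * (p - q) j := by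
        rw [← Market.jacobian_mulVec]
        simp only [Matrix.mulVec, dotProduct, hM.jacobian_apply Θ π hB]
        rfl
      rw [empMean_sub, empMean_sub, e2, empMean_sum]
      simp only [empMean_mul_const, sub_mul, Finset.sum_sub_distrib, PiLp.sub_apply,
        avgExcess_apply] at e3 ⊢
      rw [e3]
      ring
    rw [e1]
    refine (abs_add_le _ _).trans (add_le_add (abs_empMean_le (by positivity) fun i => ?_) ?_)
    · have := (hM.regular_Z k).abs_sub_sub_le hC hM.convex (t s i) (w s i) haB (hfB p hp i)
        (hfB q hq i) (hfar p hp i) (hfar q hq i)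
      simpa only [facedPrice_sub_facedPrice] using this
    · rw [Finset.sum_mul]
      refine (Finset.abs_sum_le_sum_abs _ _).trans (Finset.sum_le_sum fun j _ => ?_)
      rw [abs_mul]
      exact mul_le_mul_of_nonneg_left (abs_apply_le_norm _ j) (abs_nonneg _)
  rw [hsplit]
  refine (norm_add_le _ _).trans ?_
  have h1 := (norm_le_sum_abs _).trans (Finset.sum_le_sum fun k (_ : k ∈ Finset.univ) => hcoord k)
  simp only [Finset.sum_add_distrib, ← Finset.sum_mul, Finset.sum_const, Finset.card_univ,
    Fintype.card_fin, nsmul_eq_mul] at h1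
  have h2 := (fderiv ℝ (fun q => M.z Θ π q + q) a).le_opNorm (p - q)
  have h3 := norm_nonneg (p - q)
  rw [← hc₀] at h2
  have h4 := mul_le_mul_of_nonneg_right hrA h3
  have h5 := mul_le_mul_of_nonneg_right hE.le h3
  linarith

/-- At the mean-field price the perturbed average excess demand is of the order of the
perturbations. -/
theorem exists_norm_avgExcess_le [IsProbabilityMeasure Θ]
    (hS : AsymptoticSample Θ π F N h t w U)
    {B : Set (Price J)} {C : ℝ} (hM : M.RegularOn B C) {a : Price J} (hB : B ∈ 𝓝 a)
    (ha : M.z Θ π a = 0) :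
    ∃ K : ℝ, ∀ᶠ s in F, ‖M.avgExcess (t s) (w s) (U s) a‖ ≤ K * h s := by
  obtain ⟨R, hR, hRB⟩ := Metric.nhds_basis_closedBall.mem_iff.1 hB
  have haB : a ∈ B := mem_of_mem_nhds hB
  have hC := hM.nonneg
  have hmean : ∀ᶠ s in F, ∀ k, |(empMean fun i => M.Z (t s i) (w s i) a k) / h s| < 1 := by
    refine eventually_all.2 fun k => ?_
    have h1 := hS.mean _ ((hM.regular_Z k).tame haB)
    rw [← hM.z_apply Θ π haB, ha] at h1
    simpa [Real.dist_eq, abs_div] using Metric.tendsto_nhds.1 h1 1 one_pos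
  -- In each coordinate, moving from faced prices to `a` costs `C * J * h`, and the sample mean at
  -- `a` is at most `h` since its expectation vanishes.
  refine ⟨J * (C * J + 1), ?_⟩
  filter_upwards [hS.abs_eq, hS.pos, hS.eventually_mul_lt J hR, hmean] with s hU hpos hJ hm
  refine (norm_le_sum_abs _).trans ?_
  have hk : ∀ k, |M.avgExcess (t s) (w s) (U s) a k| ≤ (C * J + 1) * h s := by
    intro k
    rw [avgExcess_apply]
    have e : (empMean fun i => M.Z (t s i) (w s i) (Market.facedPrice (U s) a i) k) =
        empMean (fun i => M.Z (t s i) (w s i) (Market.facedPrice (U s) a i) k -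
          M.Z (t s i) (w s i) a k) + empMean fun i => M.Z (t s i) (w s i) a k := by
      rw [empMean_sub]; ring
    have hm' := (hm k).le
    rw [abs_div, abs_of_pos hpos, div_le_one hpos] at hm'
    rw [e, add_mul, one_mul]
    refine (abs_add_le _ _).trans (add_le_add (abs_empMean_le (by positivity) fun i => ?_) hm')
    have hle := norm_facedPrice_sub_le hU a i
    refine ((hM.regular_Z k).abs_sub_le hM.convex (t s i) (w s i) (hRB
      (mem_closedBall_iff_norm.2 (hle.trans hJ.le))) haB).trans ?_
    rw [mul_assoc]
    exact mul_le_mul_of_nonneg_left hle hC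
  refine (Finset.sum_le_sum fun k _ => hk k).trans (le_of_eq ?_)
  simp
  ring

end AsymptoticSample

/-- A map that differs from minus the identity by a contraction has a zero near each point where
it is small. -/
theorem exists_zero_of_contraction {E : Type*} [NormedAddCommGroup E] [NormedSpace ℝ E]
    [CompleteSpace E] {f : E → E} {a : E} {r c : ℝ} (hr : 0 ≤ r) (hc : 0 ≤ c)
    (hf : ∀ p ∈ Metric.closedBall a r, ∀ q ∈ Metric.closedBall a r,
      ‖f p - f q + (p - q)‖ ≤ c * ‖p - q‖) (ha : ‖f a‖ ≤ (1 - c) * r) : ∃ p, f p = 0 := by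
  have hlin : ApproximatesLinearOn f (-ContinuousLinearMap.id ℝ E) (Metric.closedBall a r)
      ⟨c, hc⟩ := by
    intro p hp q hq
    have h := hf p hp q hq
    change ‖f p - f q - (-ContinuousLinearMap.id ℝ E) (p - q)‖ ≤ c * ‖p - q‖
    rw [show (-ContinuousLinearMap.id ℝ E) (p - q) = -(p - q) from rfl, sub_neg_eq_add]
    exact h
  let inv : (-ContinuousLinearMap.id ℝ E).NonlinearRightInverse :=
    { toFun := fun y => -y
      nnnorm := 1
      bound' := by simp
      right_inv' := by simp }
  -- The inverse of minus the identity has norm one, so the image covers the ball of radius `(1 - c)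
  -- * r` about `f a`, which contains zero.
  obtain ⟨p, -, hp⟩ := hlin.surjOn_closedBall_of_nonlinearRightInverse inv hr le_rfl
    (show (0 : E) ∈ Metric.closedBall (f a) (((inv.nnnorm : ℝ)⁻¹ - (⟨c, hc⟩ : NNReal)) * r) by
      rw [mem_closedBall_iff_norm, zero_sub, norm_neg]
      simpa [inv] using ha)
  exact ⟨p, hp⟩

end PriceConvergence

/-! ### Consistency of the market price and its rate. -/

section MarketPrice

variable {J : ℕ} {𝒯 : Type*} [MeasurableSpace 𝒯] {M : Market J 𝒯}

theorem empMean_neg_of_nonpos {n : ℕ} {X : Fin n → ℝ} (h : ∀ i, X i ≤ 0) (h' : ∃ i, X i < 0) :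
    empMean X < 0 := by
  obtain ⟨i, hi⟩ := h'
  have hn : (0 : ℝ) < n := by exact_mod_cast i.pos
  exact mul_neg_of_pos_of_neg (inv_pos.2 hn)
    (Finset.sum_neg' (fun i _ => h i) ⟨i, Finset.mem_univ i, hi⟩)

theorem empMean_pos_of_nonneg {n : ℕ} {X : Fin n → ℝ} (h : ∀ i, 0 ≤ X i) (h' : ∃ i, 0 < X i) :
    0 < empMean X := by
  obtain ⟨i, hi⟩ := h'
  have hn : (0 : ℝ) < n := by exact_mod_cast i.pos
  exact mul_pos (inv_pos.2 hn) (Finset.sum_pos' (fun i _ => h i) ⟨i, Finset.mem_univ i, hi⟩)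

theorem priceBox_mem_nhds {l u : Fin J → ℝ} {ρ : ℝ} (hρ : 0 < ρ) {p : Price J}
    (hp : p ∈ priceBox l u) : priceBox (fun j => l j - ρ) (fun j => u j + ρ) ∈ 𝓝 p := by
  refine mem_of_superset (Metric.closedBall_mem_nhds p hρ) fun q hq => ?_
  exact mem_priceBox_of_norm_sub_le (a := 0) (by simpa using hp)
    (by simpa using mem_closedBall_iff_norm.1 hq)

namespace AsymptoticSample

variable {Θ : Measure 𝒯} [IsProbabilityMeasure Θ] {π : ℝ} {ι : Type*} {F : Filter ι} {N : ι → ℕ}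
  {h : ι → ℝ} {t : ∀ s, Fin (N s) → 𝒯} {w : ∀ s, Fin (N s) → Bool}
  {U : ∀ s, Fin (N s) → Fin J → ℝ} {price : ι → Price J}

/-- With high probability, some sampled individual lies in a set of types of positive
probability. -/
theorem eventually_exists_mem (hS : AsymptoticSample Θ π F N h t w U) (hπ0 : 0 < π) (hπ1 : π < 1)
    {A : Bool → Set 𝒯} (hAm : ∀ b, MeasurableSet (A b)) (hA : ∀ b, 0 < Θ (A b)) :
    ∀ᶠ s in F, ∃ i, t s i ∈ A (w s i) := by
  -- The fraction of individuals in the set converges to a positive number, hence is eventually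
  -- nonzero.
  have hφ : Tame fun (x : 𝒯) b => (A b).indicator (fun _ => (1 : ℝ)) x := by
    refine ⟨fun b => measurable_const.indicator (hAm b), 1, fun x b => ?_⟩
    by_cases hx : x ∈ A b <;> simp [hx]
  have hpos : 0 < mix Θ π fun (x : 𝒯) b => (A b).indicator (fun _ => (1 : ℝ)) x := by
    have hr : ∀ b, 0 < Θ.real (A b) := fun b => ENNReal.toReal_pos (hA b).ne' (measure_ne_top _ _)
    have h1 : ∀ b, ∫ x, (A b).indicator (fun _ => (1 : ℝ)) x ∂Θ = Θ.real (A b) := fun b => by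
      rw [integral_indicator_const _ (hAm b)]; simp
    simp only [mix, h1]
    have := mul_pos hπ0 (hr true)
    have := mul_pos (sub_pos.2 hπ1) (hr false)
    linarith
  filter_upwards [(hS.tendsto_empMean hφ).eventually_const_lt hpos] with s hs
  obtain ⟨i, hi⟩ := exists_ne_zero_of_empMean_ne_zero hs.ne'
  exact ⟨i, Set.mem_of_indicator_ne_zero hi⟩

/-- With high probability, the market clears exactly. -/
theorem eventually_avgExcess_eq_zero (hS : AsymptoticSample Θ π F N h t w U)
    {B : Set (Price J)} {C : ℝ} (hM : M.RegularOn B C) {a : Price J} (hB : B ∈ 𝓝 a)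
    (ha : M.z Θ π a = 0) (hc : ‖fderiv ℝ (fun q => M.z Θ π q + q) a‖ < 1)
    (hprice : ∀ᶠ s in F, M.IsMarketPrice (t s) (w s) (U s) (price s)) :
    ∀ᶠ s in F, M.avgExcess (t s) (w s) (U s) (price s) = 0 := by
  obtain ⟨r, hr, c, hc0, hc1, hcontr⟩ := hS.exists_contraction hM hB hc
  obtain ⟨K, hK⟩ := hS.exists_norm_avgExcess_le hM hB ha
  filter_upwards [hcontr, hK, hS.eventually_mul_lt K (mul_pos (sub_pos.2 hc1) hr), hprice]
    with s h1 h2 h3 h4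
  obtain ⟨p, hp⟩ := exists_zero_of_contraction hr.le hc0 h1 (h2.trans h3.le)
  have := h4 p
  rw [hp, norm_zero] at this
  exact norm_le_zero_iff.1 this

/-- With high probability, every price that clears the market exactly is close to the box. -/
theorem eventually_mem_priceBox (hS : AsymptoticSample Θ π F N h t w U) (hπ0 : 0 < π)
    (hπ1 : π < 1) {l u : Fin J → ℝ} (hb : M.BoundaryCondition Θ l u) :
    ∀ᶠ s in F, ∀ p, M.avgExcess (t s) (w s) (U s) p = 0 →
      p ∈ priceBox (fun j => l j - h s) (fun j => u j + h s) := by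
  choose Au hAum hAup hAu using hb.upper_strict
  choose Al hAlm hAlp hAl using hb.lower_strict
  have hup : ∀ᶠ s in F, ∀ j, ∃ i, t s i ∈ Au (w s i) j := eventually_all.2 fun j =>
    hS.eventually_exists_mem hπ0 hπ1 (A := fun b => Au b j) (fun b => hAum b j) fun b => hAup b j
  have hlo : ∀ᶠ s in F, ∀ j, ∃ i, t s i ∈ Al (w s i) j := eventually_all.2 fun j =>
    hS.eventually_exists_mem hπ0 hπ1 (A := fun b => Al b j) (fun b => hAlm b j) fun b => hAlp b j
  filter_upwards [hup, hlo, hS.abs_eq] with s hsu hsl hU p hp j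
  have hzero : (empMean fun i => M.Z (t s i) (w s i) (Market.facedPrice (U s) p i) j) = 0 := by
    rw [← avgExcess_apply, hp]; rfl
  have hface : ∀ i, Market.facedPrice (U s) p i j = p j + U s i j := fun i => rfl
  -- If `p j` is more than `h` outside its interval, all faced prices lie on the same side, so all
  -- excess demands for good `j` have one weak sign, and that of at least one sampled individual is
  -- strict.
  have hbd : ∀ i, -h s ≤ U s i j ∧ U s i j ≤ h s := fun i => abs_le.1 (hU i j).le
  constructor
  · by_contra! hlt
    have hlt' : ∀ i, Market.facedPrice (U s) p i j < l j := fun i => by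
      rw [hface]; simp only at hlt; linarith [(hbd i).2]
    obtain ⟨i, hi⟩ := hsl j
    exact (empMean_pos_of_nonneg (fun i => hb.lower _ _ _ j (hlt' i))
      ⟨i, hAl _ _ _ hi _ (hlt' i)⟩).ne' hzero
  · by_contra! hlt
    have hlt' : ∀ i, u j ≤ Market.facedPrice (U s) p i j := fun i => by
      rw [hface]; simp only at hlt; linarith [(hbd i).1]
    obtain ⟨i, hi⟩ := hsu j
    exact (empMean_neg_of_nonpos (fun i => hb.upper _ _ _ j (hlt' i))
      ⟨i, hAu _ _ _ hi _ (hlt' i)⟩).ne hzero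

/-- Compactness replaces a uniform law of large numbers: the prices stay in a compact enlargement of
the box, and at a fixed cluster point the pointwise law suffices. -/
theorem tendsto_price (hS : AsymptoticSample Θ π F N h t w U) (hπ0 : 0 < π) (hπ1 : π < 1)
    {l u : Fin J → ℝ} (hb : M.BoundaryCondition Θ l u) {ρ C : ℝ} (hρ : 0 < ρ)
    (hM : M.RegularOn (priceBox (fun j => l j - ρ) (fun j => u j + ρ)) C) {a : Price J}
    (ha : a ∈ priceBox l u) (hza : M.z Θ π a = 0)
    (hc : ∀ p ∈ priceBox l u, ‖fderiv ℝ (fun q => M.z Θ π q + q) p‖ < 1)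
    (hprice : ∀ᶠ s in F, M.IsMarketPrice (t s) (w s) (U s) (price s)) :
    Tendsto price F (𝓝 a) := by
  have hzero := hS.eventually_avgExcess_eq_zero hM (priceBox_mem_nhds hρ ha) hza (hc a ha) hprice
  have hbox : ∀ᶠ s in F, price s ∈ priceBox (fun j => l j - h s) (fun j => u j + h s) := by
    filter_upwards [hzero, hS.eventually_mem_priceBox hπ0 hπ1 hb] with s h1 h2 using h2 _ h1
  have hmono : ∀ {x y : ℝ}, x ≤ y → priceBox (fun j => l j - x) (fun j => u j + x) ⊆
      priceBox (fun j => l j - y) (fun j => u j + y) := fun hxy p hp =>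
    mem_priceBox_of_norm_sub_le hp (by simpa using hxy)
  refine (isCompact_priceBox (fun j => l j - ρ / 2)
    (fun j => u j + ρ / 2)).tendsto_nhds_of_unique_mapClusterPt ?_ fun q hq hcl => ?_
  · filter_upwards [hbox, hS.eventually_lt (half_pos hρ)] with s h1 h2 using hmono h2.le h1
  have hqB : q ∈ priceBox (fun j => l j - ρ) (fun j => u j + ρ) := hmono (by linarith) hq
  -- In the bound on `z`, replacing faced prices by `q` costs `C * (2 * δ)`: `δ` for the distance of
  -- the price from `q` and `δ` for the perturbation. The last `δ` is the sampling error at `q`.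
  have key : ∀ δ > 0, q ∈ priceBox (fun j => l j - (δ + δ)) (fun j => u j + (δ + δ)) ∧
      ∀ k, |M.z Θ π q k| ≤ (C * 2 + 1) * δ := by
    intro δ hδ
    have hmean : ∀ᶠ s in F, ∀ k,
        |(empMean fun i => M.Z (t s i) (w s i) q k) - M.z Θ π q k| < δ := by
      refine eventually_all.2 fun k => ?_
      rw [hM.z_apply Θ π hqB]
      simpa [Real.dist_eq] using Metric.tendsto_nhds.1
        (hS.tendsto_empMean ((hM.regular_Z k).tame hqB)) δ hδ
    have hfreq := (mapClusterPt_iff_frequently.1 hcl) _ (Metric.ball_mem_nhds q hδ)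
    obtain ⟨s, hsq, hz, hbx, hm, hhδ, hhρ, hJδ, hJρ, hU⟩ := (hfreq.and_eventually (hzero.and
      (hbox.and (hmean.and ((hS.eventually_lt hδ).and ((hS.eventually_lt (half_pos hρ)).and
        ((hS.eventually_mul_lt J hδ).and ((hS.eventually_mul_lt J (half_pos hρ)).and
          hS.abs_eq)))))))).exists
    have hsq' : ‖q - price s‖ < δ := by
      rw [← dist_eq_norm, dist_comm]; exact hsq
    refine ⟨mem_priceBox_of_norm_sub_le (hmono hhδ.le hbx) (by linarith), fun k => ?_⟩
    have hfB : ∀ i, Market.facedPrice (U s) (price s) i ∈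
        priceBox (fun j => l j - ρ) (fun j => u j + ρ) := fun i =>
      mem_priceBox_of_norm_sub_le (hmono hhρ.le hbx)
        ((norm_facedPrice_sub_le hU _ i).trans (by linarith))
    have h0 :
        (empMean fun i => M.Z (t s i) (w s i) (Market.facedPrice (U s) (price s) i) k) = 0 := by
      rw [← avgExcess_apply, hz]; rfl
    have h1 : |empMean fun i => M.Z (t s i) (w s i) q k -
        M.Z (t s i) (w s i) (Market.facedPrice (U s) (price s) i) k| ≤ C * (2 * δ) := by
      refine abs_empMean_le (mul_nonneg hM.nonneg (by linarith)) fun i => ?_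
      refine ((hM.regular_Z k).abs_sub_le hM.convex _ _ hqB (hfB i)).trans
        (mul_le_mul_of_nonneg_left ?_ hM.nonneg)
      rw [norm_sub_rev]
      refine (norm_facedPrice_sub_le' hU (price s) q i).trans ?_
      rw [norm_sub_rev]
      linarith
    rw [empMean_sub, h0, sub_zero] at h1
    have h2 := abs_le.1 (hm k).le
    have h3 := abs_le.1 h1
    rw [abs_le]
    constructor <;> nlinarith [h2.1, h2.2, h3.1, h3.2]
  -- The derivative bound is assumed on the box itself only, so uniqueness needs `q` there and not
  -- merely in an enlargement.
  have hqbox : q ∈ priceBox l u := by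
    intro j
    constructor
    · refine le_of_forall_pos_le_add fun ε hε => ?_
      have := ((key (ε / 2) (half_pos hε)).1 j).1
      simp only at this
      linarith
    · refine le_of_forall_pos_le_add fun ε hε => ?_
      have := ((key (ε / 2) (half_pos hε)).1 j).2
      simp only at this
      linarith
  have hqz : M.z Θ π q = 0 := by
    ext k
    have hK : 0 < C * 2 + 1 := by linarith [hM.nonneg]
    refine abs_nonpos_iff.1 (le_of_forall_pos_le_add fun ε hε => ?_)
    have := (key (ε / (C * 2 + 1)) (by positivity)).2 k
    rw [mul_div_cancel₀ _ hK.ne'] at this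
    simpa using this
  exact eq_of_norm_fderiv_lt_one (convex_priceBox l u)
    (fun x hx => (hM.differentiableAt_z Θ π (priceBox_mem_nhds hρ hx)).add differentiableAt_fun_id)
    hc hqbox ha (by simp [hqz]) (by simp [hza])

/-- The market price is within the order of the perturbations of the mean-field price. -/
theorem exists_norm_price_sub_le (hS : AsymptoticSample Θ π F N h t w U)
    {B : Set (Price J)} {C : ℝ} (hM : M.RegularOn B C) {a : Price J} (hB : B ∈ 𝓝 a)
    (ha : M.z Θ π a = 0) (hc : ‖fderiv ℝ (fun q => M.z Θ π q + q) a‖ < 1)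
    (hprice : ∀ᶠ s in F, M.IsMarketPrice (t s) (w s) (U s) (price s))
    (hlim : Tendsto price F (𝓝 a)) :
    ∃ K : ℝ, ∀ᶠ s in F, ‖price s - a‖ ≤ K * h s := by
  obtain ⟨r, hr, c, hc0, hc1, hcontr⟩ := hS.exists_contraction hM hB hc
  obtain ⟨K, hK⟩ := hS.exists_norm_avgExcess_le hM hB ha
  refine ⟨K / (1 - c), ?_⟩
  filter_upwards [hcontr, hK, hS.eventually_avgExcess_eq_zero hM hB ha hc hprice,
    hlim.eventually (Metric.closedBall_mem_nhds a hr)] with s h1 h2 h3 h4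
  -- As the excess vanishes at the price, the contraction compared with `a` yields `(1 - c) * ‖price
  -- s - a‖ ≤ ‖excess at a‖`.
  have h5 := h1 _ h4 a (Metric.mem_closedBall_self hr.le)
  rw [h3, zero_sub] at h5
  have h6 : ‖price s - a‖ ≤ ‖-M.avgExcess (t s) (w s) (U s) a + (price s - a)‖ +
      ‖M.avgExcess (t s) (w s) (U s) a‖ := by
    have := norm_add_le (-M.avgExcess (t s) (w s) (U s) a + (price s - a))
      (M.avgExcess (t s) (w s) (U s) a)
    rwa [neg_add_cancel_comm] at this
  rw [div_mul_eq_mul_div, le_div_iff₀ (sub_pos.2 hc1)]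
  nlinarith

end AsymptoticSample

end MarketPrice

/-- The inverse is the adjugate divided by a determinant that stays away from zero. -/
theorem tendsto_matrix_inv {ι m : Type*} [Fintype m] [DecidableEq m] {F : Filter ι}
    {A : ι → Matrix m m ℝ} {K : Matrix m m ℝ} (hA : Tendsto A F (𝓝 K)) (hK : IsUnit K.det) :
    Tendsto (fun s => (A s)⁻¹) F (𝓝 K⁻¹) := by
  simp only [Matrix.inv_def, Ring.inverse_eq_inv']
  have h1 : Tendsto (fun s => (A s).det) F (𝓝 K.det) :=
    ((continuous_id.matrix_det).tendsto K).comp hA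
  have h2 : Tendsto (fun s => (A s).adjugate) F (𝓝 K.adjugate) :=
    ((continuous_id.matrix_adjugate).tendsto K).comp hA
  exact (h1.inv₀ hK.ne_zero).smul h2

theorem eventually_isUnit_det {ι m : Type*} [Fintype m] [DecidableEq m] {F : Filter ι}
    {A : ι → Matrix m m ℝ} {K : Matrix m m ℝ} (hA : Tendsto A F (𝓝 K)) (hK : IsUnit K.det) :
    ∀ᶠ s in F, IsUnit (A s).det := by
  have h1 : Tendsto (fun s => (A s).det) F (𝓝 K.det) :=
    ((continuous_id.matrix_det).tendsto K).comp hA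
  filter_upwards [h1.eventually_ne hK.ne_zero] with s hs using isUnit_iff_ne_zero.2 hs

/-! ### Regressions in weighted and rescaled form. -/

section WeightedSlope

variable {J n : ℕ}

/-- The weighted regression without intercept, in terms of empirical means after division of the
regressors by `h`. -/
def scaledSlope (b : Fin n → ℝ) (U : Fin n → Fin J → ℝ) (V : Fin n → ℝ) (h : ℝ) : Fin J → ℝ :=
  (Matrix.of fun j k => empMean fun i => b i * (U i j / h * (U i k / h)))⁻¹ *ᵥ
    fun j => empMean (fun i => b i * (U i j / h) * V i) / h

/-- Gram matrix and cross moments both carry the factor `n * h ^ 2`, which cancels; after that each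
has a nondegenerate limit. -/
theorem inv_mulVec_eq_scaledSlope {b : Fin n → ℝ} {U : Fin n → Fin J → ℝ} {V : Fin n → ℝ} {h : ℝ}
    (hn : 0 < n) (hh : 0 < h)
    (hdet : IsUnit (Matrix.of fun j k =>
      empMean fun i => b i * (U i j / h * (U i k / h)) : Matrix (Fin J) (Fin J) ℝ).det) :
    (Matrix.of fun j k => ∑ i, b i * (U i j * U i k) : Matrix (Fin J) (Fin J) ℝ)⁻¹ *ᵥ
      (fun j => ∑ i, b i * (U i j * V i)) = scaledSlope b U V h := by
  have hn' : (0 : ℝ) < n := by exact_mod_cast hn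
  set A : Matrix (Fin J) (Fin J) ℝ :=
    Matrix.of fun j k => empMean fun i => b i * (U i j / h * (U i k / h)) with hA
  have hc : (n : ℝ) * h ^ 2 ≠ 0 := by positivity
  have e1 : (Matrix.of fun j k => ∑ i, b i * (U i j * U i k) : Matrix (Fin J) (Fin J) ℝ) =
      ((n : ℝ) * h ^ 2) • A := by
    ext j k
    simp only [hA, Matrix.of_apply, Matrix.smul_apply, empMean, smul_eq_mul]
    rw [Finset.mul_sum, Finset.mul_sum]
    refine Finset.sum_congr rfl fun i _ => ?_
    field_simp
  have e2 : (fun j => ∑ i, b i * (U i j * V i)) =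
      (n * h ^ 2) • fun j => empMean (fun i => b i * (U i j / h) * V i) / h := by
    funext j
    simp only [Pi.smul_apply, empMean, smul_eq_mul]
    rw [Finset.mul_sum, Finset.sum_div, Finset.mul_sum]
    refine Finset.sum_congr rfl fun i _ => ?_
    field_simp
  have e3 : (((n : ℝ) * h ^ 2) • A)⁻¹ = ((n : ℝ) * h ^ 2)⁻¹ • A⁻¹ := by
    refine Matrix.inv_eq_left_inv ?_
    rw [Matrix.smul_mul, Matrix.mul_smul, smul_smul, inv_mul_cancel₀ hc, one_smul,
      Matrix.nonsing_inv_mul _ hdet]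
  rw [e1, e2, e3, Matrix.mulVec_smul, Matrix.smul_mulVec, smul_smul, mul_inv_cancel₀ hc, one_smul]
  rfl

/-- The indicator of one treatment arm. -/
def armWeight (k : Bool) (b : Bool) : ℝ := if b = k then 1 else 0

theorem sum_subtype_arm (k : Bool) (w : Fin n → Bool) (f : Fin n → ℝ) :
    ∑ i : {i : Fin n // w i = k}, f i.1 = ∑ i, armWeight k (w i) * f i := by
  classical
  rw [← Finset.sum_subtype (Finset.univ.filter fun i => w i = k) (by simp) f, Finset.sum_filter]
  simp [armWeight]

/-- Zero-one weights replace the random subset of individuals, so that both arms and the full sample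
are treated by one limit theorem. -/
theorem armSlope_eq (k : Bool) (w : Fin n → Bool) (U : Fin n → Fin J → ℝ) (V : Fin n → ℝ) :
    armSlope k w (Matrix.of U) V =
      (Matrix.of fun j k' => ∑ i, armWeight k (w i) * (U i j * U i k') :
        Matrix (Fin J) (Fin J) ℝ)⁻¹ *ᵥ (fun j => ∑ i, armWeight k (w i) * (U i j * V i)) := by
  have e1 : ((Matrix.of U).submatrix (fun i : {i : Fin n // w i = k} => i.1) id)ᵀ *
      (Matrix.of U).submatrix (fun i : {i : Fin n // w i = k} => i.1) id =
      (Matrix.of fun j k' => ∑ i, armWeight k (w i) * (U i j * U i k') :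
        Matrix (Fin J) (Fin J) ℝ) := by
    ext j k'
    simp only [Matrix.mul_apply, Matrix.transpose_apply, Matrix.submatrix_apply,
      Matrix.of_apply, id]
    exact sum_subtype_arm k w fun i => U i j * U i k'
  have e2 : ((Matrix.of U).submatrix (fun i : {i : Fin n // w i = k} => i.1) id)ᵀ *ᵥ
      (fun i => V i.1) = (fun j => ∑ i, armWeight k (w i) * (U i j * V i)) := by
    funext j
    simp only [Matrix.mulVec, dotProduct, Matrix.transpose_apply, Matrix.submatrix_apply,
      Matrix.of_apply, id]
    exact sum_subtype_arm k w fun i => U i j * V i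
  rw [armSlope, slope, e1, e2]

theorem deltaZ_apply (U : Fin n → Fin J → ℝ) (Z : Matrix (Fin n) (Fin J) ℝ) (j k : Fin J) :
    deltaZ (Matrix.of U) Z j k =
      ((Matrix.of fun j k' => ∑ i, 1 * (U i j * U i k') :
        Matrix (Fin J) (Fin J) ℝ)⁻¹ *ᵥ (fun j => ∑ i, 1 * (U i j * Z i k))) j := by
  have e1 : (Matrix.of U)ᵀ * Matrix.of U =
      (Matrix.of fun j k' => ∑ i, 1 * (U i j * U i k') : Matrix (Fin J) (Fin J) ℝ) := by
    ext j k'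
    simp [Matrix.mul_apply]
  rw [deltaZ, e1]
  simp [Matrix.mul_apply, Matrix.mulVec, dotProduct]

end WeightedSlope

/-! ### Limits of the regressions on the perturbations. -/

namespace AsymptoticSample

variable {J : ℕ} {𝒯 : Type*} [MeasurableSpace 𝒯] {M : Market J 𝒯}
  {Θ : Measure 𝒯} {π : ℝ} {ι : Type*} {F : Filter ι} {N : ι → ℕ}
  {h : ι → ℝ} {t : ∀ s, Fin (N s) → 𝒯} {w : ∀ s, Fin (N s) → Bool}
  {U : ∀ s, Fin (N s) → Fin J → ℝ} {price : ι → Price J}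

/-- Of the four terms of the expansion at `a`, only the one linear in the own perturbation survives,
and there only its component along `U j`. -/
theorem tendsto_cross (hS : AsymptoticSample Θ π F N h t w U) {f : 𝒯 → Bool → Price J → ℝ}
    {B : Set (Price J)} {C : ℝ} (hf : Regular f B C) (hC : 0 ≤ C) (hconv : Convex ℝ B)
    {a : Price J} (hB : B ∈ 𝓝 a) {K : ℝ} (hK : ∀ᶠ s in F, ‖price s - a‖ ≤ K * h s)
    (b : Bool → ℝ) (j : Fin J) :
    Tendsto (fun s => empMean (fun i => b (w s i) * (U s i j / h s) *
      f (t s i) (w s i) (Market.facedPrice (U s) (price s) i)) / h s) F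
      (𝓝 (mix Θ π fun t w => b w * fderiv ℝ (f t w) a (EuclideanSpace.single j 1))) := by
  have haB := mem_of_mem_nhds hB
  obtain ⟨R, hR, hRB⟩ := Metric.nhds_basis_closedBall.mem_iff.1 hB
  obtain ⟨β, hβ⟩ := (Tame.const (𝒯 := 𝒯) b).bounded
  set g : Fin J → 𝒯 → Bool → ℝ := fun k t w =>
    fderiv ℝ (f t w) a (EuclideanSpace.single k 1) with hg
  have hgt : ∀ k, Tame fun t w => b w * g k t w := fun k =>
    (Tame.const b).mul (hf.tame_fderiv haB _)
  have hprice : ∀ k, Tendsto (fun s => (price s - a) k) F (𝓝 0) := by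
    intro k
    have h1 := hS.tendsto_zero.const_mul K
    rw [mul_zero] at h1
    refine squeeze_zero_norm' ?_ h1
    filter_upwards [hK] with s hs using (abs_apply_le_norm _ k).trans hs
  set rem : ∀ s, Fin (N s) → ℝ := fun s i =>
    f (t s i) (w s i) (Market.facedPrice (U s) (price s) i) - f (t s i) (w s i) a -
      fderiv ℝ (f (t s i) (w s i)) a (Market.facedPrice (U s) (price s) i - a) with hrem
  have h1 := hS.mean_linear _ ((Tame.const b).mul (hf.tame haB)) j
  -- The price displacement is common to all individuals and factors out of the mean, so its
  -- dependence on the sample does not matter.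
  have h2 : Tendsto (fun s => ∑ k, empMean (fun i => b (w s i) * g k (t s i) (w s i) *
      (U s i j / h s)) / h s * (price s - a) k) F (𝓝 0) := by
    have := tendsto_finsetSum (Finset.univ : Finset (Fin J)) fun k _ =>
      (hS.mean_linear _ (hgt k) j).mul (hprice k)
    simpa using this
  have h3 : Tendsto (fun s => ∑ k, empMean (fun i => b (w s i) * g k (t s i) (w s i) *
      (U s i j / h s * (U s i k / h s)))) F (𝓝 (mix Θ π fun t w => b w * g j t w)) := by
    have := tendsto_finsetSum (Finset.univ : Finset (Fin J)) fun k _ =>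
      hS.mean_quadratic _ (hgt k) j k
    simpa using this
  have h4 : Tendsto (fun s => empMean (fun i => b (w s i) * (U s i j / h s) * rem s i) / h s) F
      (𝓝 0) := by
    -- Faced prices are within `(K + J) * h` of `a`, so the remainder is of order `h ^ 2` and stays
    -- of order `h` after division by `h`.
    have hlim := hS.tendsto_zero.const_mul (|β| * (C * (K + J) * (K + J)))
    rw [mul_zero] at hlim
    refine squeeze_zero_norm' ?_ hlim
    filter_upwards [hK, hS.abs_eq, hS.pos, hS.eventually_mul_lt (K + J) hR] with s hKs hU hpos hRs
    have hd : ∀ i, ‖Market.facedPrice (U s) (price s) i - a‖ ≤ (K + J) * h s := fun i =>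
      (norm_facedPrice_sub_le' hU (price s) a i).trans (by linarith)
    rw [Real.norm_eq_abs, abs_div, abs_of_pos hpos, div_le_iff₀ hpos]
    refine abs_empMean_le ?_ fun i => ?_
    · have : 0 ≤ (K + J) * h s * ((K + J) * h s) := mul_self_nonneg _
      have : 0 ≤ |β| * (C * ((K + J) * h s * ((K + J) * h s))) := by positivity
      linarith
    · have hKJ : 0 ≤ (K + J) * h s := (norm_nonneg _).trans (hd i)
      have hr : |rem s i| ≤ C * ((K + J) * h s) * ((K + J) * h s) :=
        (hf.abs_sub_sub_le hC hconv (t s i) (w s i) haB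
          (hRB (mem_closedBall_iff_norm.2 ((hd i).trans hRs.le))) haB (hd i)
          (by simpa using hKJ)).trans
          (mul_le_mul_of_nonneg_left (hd i) (by positivity))
      have hu : |U s i j / h s| = 1 := by
        rw [abs_div, hU, abs_of_pos hpos, div_self hpos.ne']
      rw [abs_mul, abs_mul, hu, mul_one]
      calc |b (w s i)| * |rem s i| ≤ |β| * (C * ((K + J) * h s) * ((K + J) * h s)) :=
            mul_le_mul ((hβ (t s i) (w s i)).trans (le_abs_self β)) hr (abs_nonneg _) (abs_nonneg _)
        _ = |β| * (C * (K + J) * (K + J)) * h s * h s := by ring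
  have htot := ((h1.add h2).add h3).add h4
  simp only [zero_add, add_zero] at htot
  refine htot.congr' ?_
  filter_upwards [hS.pos] with s hpos
  have hdecomp : (fun i => b (w s i) * (U s i j / h s) *
      f (t s i) (w s i) (Market.facedPrice (U s) (price s) i)) = fun i =>
      b (w s i) * f (t s i) (w s i) a * (U s i j / h s) +
      (∑ k, b (w s i) * g k (t s i) (w s i) * (U s i j / h s) * (price s - a) k) +
      (∑ k, b (w s i) * g k (t s i) (w s i) * (U s i j / h s * (U s i k / h s)) * h s) +
      b (w s i) * (U s i j / h s) * rem s i := by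
    funext i
    have hL : fderiv ℝ (f (t s i) (w s i)) a (Market.facedPrice (U s) (price s) i - a) =
        ∑ k, g k (t s i) (w s i) * (price s - a) k + ∑ k, g k (t s i) (w s i) * U s i k := by
      rw [clm_apply_eq_sum, ← Finset.sum_add_distrib]
      refine Finset.sum_congr rfl fun k _ => ?_
      simp only [hg, Market.facedPrice, PiLp.sub_apply, PiLp.add_apply]
      ring
    have hF : f (t s i) (w s i) (Market.facedPrice (U s) (price s) i) = f (t s i) (w s i) a +
        (∑ k, g k (t s i) (w s i) * (price s - a) k + ∑ k, g k (t s i) (w s i) * U s i k) +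
        rem s i := by
      rw [hrem, ← hL]; ring
    rw [hF, mul_add, mul_add, mul_add, Finset.mul_sum, Finset.mul_sum, ← add_assoc]
    congr 1
    congr 1
    · congr 1
      · ring
      · exact Finset.sum_congr rfl fun k _ => by ring
    · exact Finset.sum_congr rfl fun k _ => by field_simp
  rw [hdecomp, empMean_add, empMean_add, empMean_add, empMean_sum, empMean_sum]
  simp only [empMean_mul_const _ (h s), empMean_mul_const _ ((price s - a) _)]
  rw [← Finset.sum_mul, add_div, add_div, add_div, mul_div_cancel_right₀ _ hpos.ne', Finset.sum_div]
  simp only [div_mul_eq_mul_div]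

theorem tendsto_gram (hS : AsymptoticSample Θ π F N h t w U) (b : Bool → ℝ) :
    Tendsto (fun s => (Matrix.of fun j k => empMean fun i =>
      b (w s i) * (U s i j / h s * (U s i k / h s)) : Matrix (Fin J) (Fin J) ℝ)) F
      (𝓝 ((mix Θ π fun _ w => b w) • 1)) := by
  refine tendsto_pi_nhds.2 fun j => tendsto_pi_nhds.2 fun k => ?_
  have := hS.mean_quadratic _ (Tame.const b) j k
  simpa [Matrix.smul_apply, Matrix.one_apply] using this

theorem isUnit_det_smul_one {m : ℝ} (hm : m ≠ 0) :
    IsUnit (m • (1 : Matrix (Fin J) (Fin J) ℝ)).det := by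
  simp [hm]

theorem tendsto_scaledSlope (hS : AsymptoticSample Θ π F N h t w U)
    {f : 𝒯 → Bool → Price J → ℝ}
    {B : Set (Price J)} {C : ℝ} (hf : Regular f B C) (hC : 0 ≤ C) (hconv : Convex ℝ B)
    {a : Price J} (hB : B ∈ 𝓝 a) {K : ℝ} (hK : ∀ᶠ s in F, ‖price s - a‖ ≤ K * h s)
    (b : Bool → ℝ) (hb : mix Θ π (fun _ w => b w) ≠ 0) :
    Tendsto (fun s => (Matrix.of fun j k => ∑ i, b (w s i) * (U s i j * U s i k) :
        Matrix (Fin J) (Fin J) ℝ)⁻¹ *ᵥ (fun j => ∑ i, b (w s i) * (U s i j *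
          f (t s i) (w s i) (Market.facedPrice (U s) (price s) i)))) F
      (𝓝 fun j => (mix Θ π fun _ w => b w)⁻¹ *
        mix Θ π fun t w => b w * fderiv ℝ (f t w) a (EuclideanSpace.single j 1)) := by
  have hG := hS.tendsto_gram b
  have hu := isUnit_det_smul_one (J := J) hb
  have hcross := tendsto_pi_nhds.2 fun j => hS.tendsto_cross hf hC hconv hB hK b j
  have hlim := ((continuous_fst.matrix_mulVec continuous_snd).tendsto
    (((mix Θ π fun _ w => b w) • (1 : Matrix (Fin J) (Fin J) ℝ))⁻¹, fun j : Fin J =>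
      mix Θ π fun t w => b w * fderiv ℝ (f t w) a (EuclideanSpace.single j 1))).comp
    ((tendsto_matrix_inv hG hu).prodMk_nhds hcross)
  have hval : ((mix Θ π fun _ w => b w) • (1 : Matrix (Fin J) (Fin J) ℝ))⁻¹ *ᵥ
      (fun j : Fin J => mix Θ π fun t w => b w * fderiv ℝ (f t w) a (EuclideanSpace.single j 1)) =
      fun j => (mix Θ π fun _ w => b w)⁻¹ *
        mix Θ π fun t w => b w * fderiv ℝ (f t w) a (EuclideanSpace.single j 1) := by
    have e : ((mix Θ π fun _ w => b w) • (1 : Matrix (Fin J) (Fin J) ℝ))⁻¹ =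
        (mix Θ π fun _ w => b w)⁻¹ • 1 := by
      refine Matrix.inv_eq_left_inv ?_
      rw [Matrix.smul_mul, Matrix.mul_smul, smul_smul, inv_mul_cancel₀ hb, one_smul, one_mul]
    rw [e, Matrix.smul_mulVec, Matrix.one_mulVec]
    rfl
  rw [← hval]
  refine hlim.congr' ?_
  filter_upwards [eventually_isUnit_det hG hu, hS.size_pos, hS.pos] with s h1 h2 h3
  rw [inv_mulVec_eq_scaledSlope h2 h3 h1]
  rfl

theorem tendsto_armSlope [IsProbabilityMeasure Θ]
    (hS : AsymptoticSample Θ π F N h t w U) (hπ0 : 0 < π) (hπ1 : π < 1)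
    {B : Set (Price J)} {C : ℝ} (hM : M.RegularOn B C)
    {a : Price J} (hB : B ∈ 𝓝 a) {K : ℝ} (hK : ∀ᶠ s in F, ‖price s - a‖ ≤ K * h s) (k : Bool) :
    Tendsto (fun s => armSlope k (w s) (Matrix.of (U s)) (M.obsY (t s) (w s) (U s) (price s))) F
      (𝓝 fun j => ∫ t, fderiv ℝ (M.Y t k) a (EuclideanSpace.single j 1) ∂Θ) := by
  have hm : mix Θ π (fun _ w => armWeight k w) = if k then π else 1 - π := by
    cases k <;> simp [mix, armWeight]
  have hm0 : mix Θ π (fun _ w => armWeight k w) ≠ 0 := by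
    rw [hm]
    split_ifs
    · exact hπ0.ne'
    · exact (sub_pos.2 hπ1).ne'
  have h1 := hS.tendsto_scaledSlope hM.regular_Y hM.nonneg hM.convex hB hK (armWeight k) hm0
  have e : (fun j => (mix Θ π fun _ w => armWeight k w)⁻¹ * mix Θ π fun t w =>
      armWeight k w * fderiv ℝ (M.Y t w) a (EuclideanSpace.single j 1)) =
      fun j => ∫ t, fderiv ℝ (M.Y t k) a (EuclideanSpace.single j 1) ∂Θ := by
    funext j
    rw [inv_mul_eq_iff_eq_mul₀ hm0, hm]
    cases k <;> simp [mix, armWeight]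
  rw [e] at h1
  refine h1.congr fun s => ?_
  rw [armSlope_eq]
  rfl

/-- The transpose arises because the row of `deltaZ` indexes the perturbed price and the column the
responding good. -/
theorem tendsto_deltaZ [IsProbabilityMeasure Θ] (hS : AsymptoticSample Θ π F N h t w U)
    {B : Set (Price J)} {C : ℝ} (hM : M.RegularOn B C)
    {a : Price J} (hB : B ∈ 𝓝 a) {K : ℝ} (hK : ∀ᶠ s in F, ‖price s - a‖ ≤ K * h s) :
    Tendsto (fun s => deltaZ (Matrix.of (U s)) (M.obsZ (t s) (w s) (U s) (price s))) F
      (𝓝 (M.jacobian Θ π a)ᵀ) := by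
  refine tendsto_pi_nhds.2 fun j => tendsto_pi_nhds.2 fun k => ?_
  have hm : mix Θ π (fun _ _ => (1 : ℝ)) = 1 := by simp [mix]
  have h1 := tendsto_pi_nhds.1 (hS.tendsto_scaledSlope (hM.regular_Z k) hM.nonneg hM.convex hB hK
    (fun _ => 1) (by rw [hm]; exact one_ne_zero)) j
  rw [Matrix.transpose_apply, hM.jacobian_apply Θ π hB]
  simp only [hm, inv_one, one_mul] at h1
  refine h1.congr fun s => ?_
  rw [deltaZ_apply]
  simp only [one_mul]
  rfl

end AsymptoticSample

theorem empVar_eq {n : ℕ} (hn : 0 < n) (X : Fin n → ℝ) :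
    empVar X = empMean (fun i => X i ^ 2) - empMean X ^ 2 := by
  have hn' : (n : ℝ) ≠ 0 := by exact_mod_cast hn.ne'
  have h1 : ∑ i, X i = n * empMean X := by
    rw [empMean]; field_simp
  have h2 : ∑ i, (X i - empMean X) ^ 2 = ∑ i, X i ^ 2 - n * empMean X ^ 2 := by
    have : ∀ i, (X i - empMean X) ^ 2 = X i ^ 2 - 2 * empMean X * X i + empMean X ^ 2 := fun i => by
      ring
    simp only [this, Finset.sum_add_distrib, Finset.sum_sub_distrib, ← Finset.mul_sum, h1]
    simp
    ring
  rw [empVar, h2]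
  simp only [empMean]
  field_simp

/-! ### The asymptotic variance and its plug-in estimator. -/

section Variance

variable {J : ℕ} {𝒯 : Type*} [MeasurableSpace 𝒯]

/-- Inverse propensity weights. -/
def ipw (π : ℝ) (b : Bool) : ℝ := ind b / π - (1 - ind b) / (1 - π)

/-- The factor of the adjustment that depends on the treatment. -/
def adjustmentSign (π : ℝ) (b : Bool) : ℝ := -ind b * π + (1 - ind b) * (1 - π)

/-- The summand of the estimator with estimated quantities replaced by their limits. -/
def influence (M : Market J 𝒯) (π : ℝ) (a : Price J) (θ : Fin J → ℝ) (t : 𝒯) (b : Bool) : ℝ :=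
  ipw π b * (M.Y t b a + adjustmentSign π b * (θ ⬝ᵥ (M.Z t b a).ofLp))

theorem Market.RegularOn.tame_influence {M : Market J 𝒯} {B : Set (Price J)} {C : ℝ}
    (hM : M.RegularOn B C) (π : ℝ) {a : Price J} (ha : a ∈ B) (θ : Fin J → ℝ) :
    Tame (influence M π a θ) :=
  (Tame.const (ipw π)).mul ((hM.regular_Y.tame ha).add ((Tame.const (adjustmentSign π)).mul
    (Tame.sum _ fun k => (Tame.const fun _ => θ k).mul ((hM.regular_Z k).tame ha))))

theorem integral_add_add_const_mul {Θ : Measure 𝒯} {f g k : 𝒯 → ℝ} (hf : Integrable f Θ)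
    (hg : Integrable g Θ) (hk : Integrable k Θ) (a b c : ℝ) :
    ∫ t, (a * f t + b * g t + c * k t) ∂Θ =
      a * (∫ t, f t ∂Θ) + b * (∫ t, g t ∂Θ) + c * ∫ t, k t ∂Θ := by
  have h1 : Integrable (fun t => a * f t + b * g t) Θ := (hf.const_mul a).add (hg.const_mul b)
  rw [integral_add h1 (hk.const_mul c), integral_add (hf.const_mul a) (hg.const_mul b),
    integral_const_mul, integral_const_mul, integral_const_mul]

/-- With `f` the adjusted outcome, `R` is `f₁ / π + f₀ / (1 - π)` and `T` is `f₁ - f₀`. In `π (1 -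
π) E[R²] + E[T²]` the products `f₁ f₀` cancel, leaving `E[f₁²] / π + E[f₀²] / (1 - π)`, the second
moment of the inverse propensity weighted `f`; the mean of the latter is `E[T]`. -/
theorem mix_sq_sub_sq_mix_influence {M : Market J 𝒯} {B : Set (Price J)} {C : ℝ}
    (hM : M.RegularOn B C) (Θ : Measure 𝒯) [IsProbabilityMeasure Θ] {π : ℝ} (hπ0 : 0 < π)
    (hπ1 : π < 1) {a : Price J} (ha : a ∈ B) (H : Matrix (Fin J) (Fin J) ℝ) :
    (mix Θ π fun t b => influence M π a (M.effectGradient Θ a ᵥ* H⁻¹) t b ^ 2) -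
      (mix Θ π (influence M π a (M.effectGradient Θ a ᵥ* H⁻¹))) ^ 2 = M.sigmaSq Θ π a H := by
  set θ := M.effectGradient Θ a ᵥ* H⁻¹ with hθ
  have h1 : π ≠ 0 := hπ0.ne'
  have h2 : 1 - π ≠ 0 := (sub_pos.2 hπ1).ne'
  set f : 𝒯 → Bool → ℝ := fun t b => M.Y t b a + adjustmentSign π b * (θ ⬝ᵥ (M.Z t b a).ofLp)
    with hf
  have hft : Tame f := (hM.regular_Y.tame ha).add ((Tame.const (adjustmentSign π)).mul
    (Tame.sum _ fun k => (Tame.const fun _ => θ k).mul ((hM.regular_Z k).tame ha)))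
  have hR : ∀ t, M.R Θ π a H t = f t true / π + f t false / (1 - π) := by
    intro t
    simp only [Market.R, Matrix.dotProduct_mulVec, ← hθ, hf, adjustmentSign, ind, WithLp.ofLp_sub,
      dotProduct_sub]
    simp
    field_simp
    ring
  have hT : ∀ t, M.T Θ π a H t = f t true - f t false := by
    intro t
    simp only [Market.T, Matrix.dotProduct_mulVec, ← hθ, hf, adjustmentSign, ind, WithLp.ofLp_add,
      WithLp.ofLp_smul, dotProduct_add, dotProduct_smul, smul_eq_mul]
    simp
    ring
  have hTm : Tame fun t (_ : Bool) => f t true - f t false := by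
    obtain ⟨A, hA⟩ := hft.bounded
    exact ⟨fun _ => (hft.measurable true).sub (hft.measurable false), A + A, fun t _ =>
      (abs_sub _ _).trans (add_le_add (hA t true) (hA t false))⟩
  have hi : ∀ b, Integrable (fun t => f t b) Θ := hft.integrable Θ
  have hisq : ∀ b, Integrable (fun t => f t b * f t b) Θ := (hft.mul hft).integrable Θ
  have hic : Integrable (fun t => f t true * f t false) Θ := by
    obtain ⟨A, hA⟩ := hft.bounded
    exact (hi false).bdd_mul (hft.measurable true).aestronglyMeasurable
      (ae_of_all _ fun t => hA t true)
  have hvar : variance (M.T Θ π a H) Θ =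
      (∫ t, (f t true - f t false) ^ 2 ∂Θ) - (∫ t, (f t true - f t false) ∂Θ) ^ 2 := by
    have e : M.T Θ π a H = fun t => f t true - f t false := funext hT
    rw [e, variance_eq_sub]
    · rfl
    · obtain ⟨A, hA⟩ := hTm.bounded
      exact MemLp.of_bound (hTm.measurable true).aestronglyMeasurable A
        (ae_of_all _ fun t => hA t true)
  have hsqT : ∫ t, (f t true - f t false) ^ 2 ∂Θ = (∫ t, f t true * f t true ∂Θ) -
      2 * (∫ t, f t true * f t false ∂Θ) + ∫ t, f t false * f t false ∂Θ := by
    have e : (fun t => (f t true - f t false) ^ 2) = fun t =>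
        1 * (f t true * f t true) + (-2) * (f t true * f t false) +
          1 * (f t false * f t false) := by
      funext t; ring
    rw [e, integral_add_add_const_mul (hisq true) hic (hisq false)]
    ring
  have hsqR : ∫ t, (M.R Θ π a H t) ^ 2 ∂Θ = (1 / π ^ 2) * (∫ t, f t true * f t true ∂Θ) +
      (2 / (π * (1 - π))) * (∫ t, f t true * f t false ∂Θ) +
      (1 / (1 - π) ^ 2) * ∫ t, f t false * f t false ∂Θ := by
    have e : (fun t => (M.R Θ π a H t) ^ 2) = fun t =>
        (1 / π ^ 2) * (f t true * f t true) + (2 / (π * (1 - π))) * (f t true * f t false) +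
          (1 / (1 - π) ^ 2) * (f t false * f t false) := by
      funext t
      rw [hR]
      field_simp
      ring
    rw [e, integral_add_add_const_mul (hisq true) hic (hisq false)]
  have hinf : ∀ t b, influence M π a θ t b = ipw π b * f t b := fun _ _ => rfl
  have hmsq : (mix Θ π fun t b => influence M π a θ t b ^ 2) =
      (1 / π) * (∫ t, f t true * f t true ∂Θ) +
        (1 / (1 - π)) * ∫ t, f t false * f t false ∂Θ := by
    have e1 : ∀ t, influence M π a θ t true ^ 2 = (1 / π ^ 2) * (f t true * f t true) := fun t => by
      rw [hinf]; simp [ipw, ind]; field_simp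
    have e2 : ∀ t, influence M π a θ t false ^ 2 = (1 / (1 - π) ^ 2) * (f t false * f t false) :=
      fun t => by rw [hinf]; simp [ipw, ind]; field_simp
    simp only [mix, e1, e2, integral_const_mul]
    field_simp
  have hm : mix Θ π (influence M π a θ) = ∫ t, (f t true - f t false) ∂Θ := by
    have e1 : ∀ t, influence M π a θ t true = (1 / π) * f t true := fun t => by
      rw [hinf]; simp [ipw, ind]
    have e2 : ∀ t, influence M π a θ t false = -(1 / (1 - π)) * f t false := fun t => by
      rw [hinf]; simp [ipw, ind]
    rw [integral_sub (hi true) (hi false)]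
    simp only [mix, e1, e2, integral_const_mul]
    field_simp
    ring
  rw [Market.sigmaSq, hvar, hsqT, hsqR, hmsq, hm]
  field_simp
  ring

theorem abs_ipw_le {π : ℝ} (hπ0 : 0 < π) (hπ1 : π < 1) (b : Bool) :
    |ipw π b| ≤ 1 / π + 1 / (1 - π) := by
  have h1 : 0 < 1 / π := one_div_pos.2 hπ0
  have h2 : 0 < 1 / (1 - π) := one_div_pos.2 (sub_pos.2 hπ1)
  cases b
  · simp only [ipw, ind, Bool.false_eq_true, if_false, zero_div, sub_zero, zero_sub, abs_neg,
      abs_of_pos h2]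
    linarith
  · simp only [ipw, ind, if_true, sub_self, zero_div, sub_zero, abs_of_pos h1]
    linarith

theorem abs_adjustmentSign_le {π : ℝ} (hπ0 : 0 < π) (hπ1 : π < 1) (b : Bool) :
    |adjustmentSign π b| ≤ 1 := by
  cases b <;> simp only [adjustmentSign, ind, Bool.false_eq_true, if_false, if_true] <;>
    rw [abs_le] <;> constructor <;> linarith

variable {M : Market J 𝒯} {Θ : Measure 𝒯} {π : ℝ} {ι : Type*} {F : Filter ι} {N : ι → ℕ}
  {h : ι → ℝ} {t : ∀ s, Fin (N s) → 𝒯} {w : ∀ s, Fin (N s) → Bool}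
  {U : ∀ s, Fin (N s) → Fin J → ℝ} {price : ι → Price J}

/-- The empirical variance of uniformly small perturbations of bounded i.i.d. variables is
consistent. -/
theorem AsymptoticSample.tendsto_empVar (hS : AsymptoticSample Θ π F N h t w U)
    {φ : 𝒯 → Bool → ℝ} (hφ : Tame φ) {X : ∀ s, Fin (N s) → ℝ} {d : ι → ℝ}
    (hd : Tendsto d F (𝓝 0)) (hd0 : ∀ᶠ s in F, 0 ≤ d s)
    (hX : ∀ᶠ s in F, ∀ i, |X s i - φ (t s i) (w s i)| ≤ d s) :
    Tendsto (fun s => empVar (X s)) F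
      (𝓝 ((mix Θ π fun t b => φ t b ^ 2) - mix Θ π φ ^ 2)) := by
  obtain ⟨B, hB⟩ := hφ.bounded
  have hφ2 : Tame fun t b => φ t b ^ 2 := by simpa only [sq] using hφ.mul hφ
  have h1 : Tendsto (fun s => empMean (X s)) F (𝓝 (mix Θ π φ)) := by
    have hz : Tendsto (fun s => empMean (fun i => X s i - φ (t s i) (w s i))) F (𝓝 0) := by
      refine squeeze_zero_norm' ?_ hd
      filter_upwards [hX, hd0] with s hs hs0 using abs_empMean_le hs0 hs
    have := hz.add (hS.tendsto_empMean hφ)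
    rw [zero_add] at this
    refine this.congr fun s => ?_
    rw [empMean_sub]; ring
  have h2 : Tendsto (fun s => empMean fun i => X s i ^ 2) F (𝓝 (mix Θ π fun t b => φ t b ^ 2)) := by
    have hlim : Tendsto (fun s => d s * (d s + 2 * |B|)) F (𝓝 0) := by
      have := hd.mul (hd.add_const (2 * |B|))
      simpa using this
    have hz : Tendsto (fun s => empMean (fun i => X s i ^ 2 - φ (t s i) (w s i) ^ 2)) F (𝓝 0) := by
      refine squeeze_zero_norm' ?_ hlim
      filter_upwards [hX, hd0] with s hs hs0
      refine abs_empMean_le (by positivity) fun i => ?_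
      have e : X s i ^ 2 - φ (t s i) (w s i) ^ 2 =
          (X s i - φ (t s i) (w s i)) * ((X s i - φ (t s i) (w s i)) + 2 * φ (t s i) (w s i)) := by
        ring
      rw [e, abs_mul]
      refine mul_le_mul (hs i) ((abs_add_le _ _).trans (add_le_add (hs i) ?_)) (abs_nonneg _) hs0
      rw [abs_mul, abs_two]
      exact mul_le_mul_of_nonneg_left ((hB _ _).trans (le_abs_self B)) zero_le_two
    have := hz.add (hS.tendsto_empMean hφ2)
    rw [zero_add] at this
    refine this.congr fun s => ?_
    rw [empMean_sub]; ring
  refine (h2.sub (h1.pow 2)).congr' ?_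
  filter_upwards [hS.size_pos] with s hs
  rw [empVar_eq hs]

theorem tendsto_vecMul_inv {ι m : Type*} [Fintype m] [DecidableEq m] {F : Filter ι}
    {g : ι → m → ℝ} {γ : m → ℝ} {A : ι → Matrix m m ℝ} {K : Matrix m m ℝ}
    (hg : Tendsto g F (𝓝 γ)) (hA : Tendsto A F (𝓝 K)) (hK : IsUnit K.det) :
    Tendsto (fun s => g s ᵥ* (A s)⁻¹) F (𝓝 (γ ᵥ* K⁻¹)) := by
  have hc : Continuous fun x : (m → ℝ) × Matrix m m ℝ => x.1 ᵥ* x.2 :=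
    continuous_fst.matrix_vecMul continuous_snd
  exact (hc.tendsto (γ, K⁻¹)).comp (hg.prodMk_nhds (tendsto_matrix_inv hA hK))

theorem AsymptoticSample.tendsto_armSlope_sub [IsProbabilityMeasure Θ]
    (hS : AsymptoticSample Θ π F N h t w U) (hπ0 : 0 < π) (hπ1 : π < 1)
    {B : Set (Price J)} {C : ℝ} (hM : M.RegularOn B C)
    {a : Price J} (hB : B ∈ 𝓝 a) {K : ℝ} (hK : ∀ᶠ s in F, ‖price s - a‖ ≤ K * h s) :
    Tendsto (fun s =>
      armSlope true (w s) (Matrix.of (U s)) (M.obsY (t s) (w s) (U s) (price s)) -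
        armSlope false (w s) (Matrix.of (U s)) (M.obsY (t s) (w s) (U s) (price s))) F
      (𝓝 (M.effectGradient Θ a)) := by
  have e : M.effectGradient Θ a = (fun j => ∫ t, fderiv ℝ (M.Y t true) a
      (EuclideanSpace.single j 1) ∂Θ) - fun j => ∫ t, fderiv ℝ (M.Y t false) a
      (EuclideanSpace.single j 1) ∂Θ := funext fun j => hM.effectGradient_apply Θ hB j
  rw [e]
  exact (hS.tendsto_armSlope hπ0 hπ1 hM hB hK true).sub
    (hS.tendsto_armSlope hπ0 hπ1 hM hB hK false)

/-- Faced prices approach `a` uniformly over individuals and the estimated coefficients converge, so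
the summands approach `influence` uniformly. Only the limit of `Δ` and its invertibility matter. -/
theorem AsymptoticSample.tendsto_sigmaHatSq [IsProbabilityMeasure Θ]
    (hS : AsymptoticSample Θ π F N h t w U) (hπ0 : 0 < π) (hπ1 : π < 1)
    {B : Set (Price J)} {C : ℝ} (hM : M.RegularOn B C)
    {a : Price J} (hB : B ∈ 𝓝 a) {K : ℝ} (hK : ∀ᶠ s in F, ‖price s - a‖ ≤ K * h s)
    {Δ : ι → Matrix (Fin J) (Fin J) ℝ} {H : Matrix (Fin J) (Fin J) ℝ}
    (hΔ : Tendsto Δ F (𝓝 H)) (hH : IsUnit H.det) :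
    Tendsto (fun s => sigmaHatSq π (w s) (Matrix.of (U s))
      (M.obsY (t s) (w s) (U s) (price s)) (M.obsZ (t s) (w s) (U s) (price s)) (Δ s)) F
      (𝓝 (M.sigmaSq Θ π a H)) := by
  have haB := mem_of_mem_nhds hB
  obtain ⟨R, hR, hRB⟩ := Metric.nhds_basis_closedBall.mem_iff.1 hB
  have hC := hM.nonneg
  -- Moving the inverse matrix onto the gradient collects all estimated quantities in one
  -- coefficient vector common to all individuals.
  set θ := M.effectGradient Θ a ᵥ* H⁻¹ with hθ
  set g : ι → Fin J → ℝ := fun s =>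
    armSlope true (w s) (Matrix.of (U s)) (M.obsY (t s) (w s) (U s) (price s)) -
      armSlope false (w s) (Matrix.of (U s)) (M.obsY (t s) (w s) (U s) (price s)) with hg
  have hglim : Tendsto g F (𝓝 (M.effectGradient Θ a)) :=
    hS.tendsto_armSlope_sub hπ0 hπ1 hM hB hK
  set θs : ι → Fin J → ℝ := fun s => g s ᵥ* (Δ s)⁻¹ with hθs
  have hθlim : Tendsto θs F (𝓝 θ) := tendsto_vecMul_inv hglim hΔ hH
  set S : ℝ := 1 / π + 1 / (1 - π) with hSdef
  have hS0 : 0 ≤ S := (abs_nonneg _).trans (abs_ipw_le hπ0 hπ1 true)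
  -- The three contributions are the shift of the outcome, the error of the coefficients times the
  -- bound on excess demand, and the limiting coefficients times the shift of excess demand.
  set d : ι → ℝ := fun s => S * (C * ((K + J) * h s) +
    ∑ k, (|θs s k - θ k| * C + |θ k| * (C * ((K + J) * h s)))) with hddef
  have hd : Tendsto d F (𝓝 0) := by
    have hh : Tendsto (fun s => C * ((K + J) * h s)) F (𝓝 0) := by
      simpa using (hS.tendsto_zero.const_mul (K + J)).const_mul C
    have hsum : Tendsto (fun s => ∑ k, (|θs s k - θ k| * C + |θ k| * (C * ((K + J) * h s)))) F
        (𝓝 (∑ k, (|θ k - θ k| * C + |θ k| * 0))) :=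
      tendsto_finsetSum _ fun k _ =>
        ((((tendsto_pi_nhds.1 hθlim k).sub_const _).abs).mul_const C).add (hh.const_mul _)
    simpa using (hh.add hsum).const_mul S
  have hclose : ∀ᶠ s in F, ∀ i, ‖Market.facedPrice (U s) (price s) i - a‖ ≤ (K + J) * h s ∧
      Market.facedPrice (U s) (price s) i ∈ B := by
    filter_upwards [hK, hS.abs_eq, hS.eventually_mul_lt (K + J) hR] with s hKs hU hRs i
    have hle : ‖Market.facedPrice (U s) (price s) i - a‖ ≤ (K + J) * h s :=
      (norm_facedPrice_sub_le' hU (price s) a i).trans (by linarith)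
    exact ⟨hle, hRB (mem_closedBall_iff_norm.2 (hle.trans hRs.le))⟩
  have hKJ : ∀ᶠ s in F, 0 ≤ (K + J) * h s := by
    filter_upwards [hK, hS.pos] with s h1 h2
    have := (norm_nonneg _).trans h1
    have : 0 ≤ J * h s := by positivity
    linarith
  rw [← mix_sq_sub_sq_mix_influence hM Θ hπ0 hπ1 haB H]
  refine hS.tendsto_empVar (hM.tame_influence π haB θ) hd ?_ ?_
  · filter_upwards [hKJ] with s hs
    positivity
  · filter_upwards [hclose, hKJ] with s hs hs0 i
    obtain ⟨hle, hmem⟩ := hs i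
    set q := Market.facedPrice (U s) (price s) i with hq
    have hadj : adjustment π (w s) (Matrix.of (U s)) (M.obsY (t s) (w s) (U s) (price s))
        (M.obsZ (t s) (w s) (U s) (price s)) (Δ s) i =
        adjustmentSign π (w s i) * (θs s ⬝ᵥ (M.Z (t s i) (w s i) q).ofLp) := by
      rw [adjustment, Matrix.dotProduct_mulVec, adjustmentSign, add_mul]
      simp only [neg_mul, mul_assoc]
      rfl
    have hY : M.obsY (t s) (w s) (U s) (price s) i = M.Y (t s i) (w s i) q := rfl
    rw [hadj, hY, influence]
    change |ipw π (w s i) * _ - _| ≤ _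
    rw [← mul_sub, abs_mul]
    refine mul_le_mul (abs_ipw_le hπ0 hπ1 _) ?_ (abs_nonneg _) hS0
    rw [add_sub_add_comm, ← mul_sub]
    have hLip : ∀ {x : ℝ}, x ≤ C * ‖q - a‖ → x ≤ C * ((K + J) * h s) := fun hx =>
      hx.trans (mul_le_mul_of_nonneg_left hle hC)
    refine (abs_add_le _ _).trans (add_le_add
      (hLip (hM.regular_Y.abs_sub_le hM.convex _ _ hmem haB)) ?_)
    rw [abs_mul]
    refine (mul_le_of_le_one_left (abs_nonneg _) (abs_adjustmentSign_le hπ0 hπ1 _)).trans ?_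
    simp only [dotProduct]
    rw [← Finset.sum_sub_distrib]
    refine (Finset.abs_sum_le_sum_abs _ _).trans (Finset.sum_le_sum fun k _ => ?_)
    have e : θs s k * M.Z (t s i) (w s i) q k - θ k * M.Z (t s i) (w s i) a k =
        (θs s k - θ k) * M.Z (t s i) (w s i) q k +
          θ k * (M.Z (t s i) (w s i) q k - M.Z (t s i) (w s i) a k) := by ring
    rw [e]
    refine (abs_add_le _ _).trans ?_
    rw [abs_mul, abs_mul]
    exact add_le_add
      (mul_le_mul_of_nonneg_left ((hM.regular_Z k).abs_le _ _ _ hmem) (abs_nonneg _))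
      (mul_le_mul_of_nonneg_left (hLip ((hM.regular_Z k).abs_sub_le hM.convex _ _ hmem haB))
        (abs_nonneg _))

end Variance

end MarketExperiment

end

theorem proposition1 {J : ℕ} {𝒯 : Type*} [MeasurableSpace 𝒯]
    (Θ : Measure 𝒯) [IsProbabilityMeasure Θ] (M : Market J 𝒯)
    (l u : Fin J → ℝ) (hboundary : M.BoundaryCondition Θ l u) (hsmooth : M.SmoothBounded l u)
    (π : ℝ) (hπ0 : 0 < π) (hπ1 : π < 1)
    (hcontraction : ∀ p ∈ priceBox l u, ‖fderiv ℝ (fun q => M.z Θ π q + q) p‖ < 1)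
    (pstar : Price J) (hpstar_mem : pstar ∈ priceBox l u) (hpstar : M.z Θ π pstar = 0)
    (c α : ℝ) (hc : 0 < c) (hα0 : 1 / 4 < α) (hα1 : α < 1 / 2)
    {Ω : ℕ → Type*} [∀ n, MeasurableSpace (Ω n)]
    (P : ∀ n, Measure (Ω n)) [∀ n, IsProbabilityMeasure (P n)]
    (t : ∀ n, Ω n → Fin n → 𝒯) (W : ∀ n, Ω n → Fin n → Bool)
    (U : ∀ n, Ω n → Fin n → Fin J → ℝ)
    (hlaw : ∀ n, HasLaw (fun ω i => (t n ω i, W n ω i, U n ω i))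
      (sampleLaw Θ π J (c * (n : ℝ) ^ (-α)) n) (P n))
    (price : ∀ n, Ω n → Price J)
    (hprice : ∀ n, ∀ᵐ ω ∂(P n), M.IsMarketPrice (t n ω) (W n ω) (U n ω) (price n ω)) :
    TendstoInProbability P
      (fun n ω =>
        sigmaHatSq π (W n ω) (Matrix.of (U n ω))
          (M.obsY (t n ω) (W n ω) (U n ω) (price n ω))
          (M.obsZ (t n ω) (W n ω) (U n ω) (price n ω))
          (deltaZ (Matrix.of (U n ω)) (M.obsZ (t n ω) (W n ω) (U n ω) (price n ω)))ᵀ)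
      (M.sigmaSq Θ π pstar (M.jacobian Θ π pstar)) ∧
    TendstoInProbability P
      (fun n ω =>
        sigmaHatSq π (W n ω) (Matrix.of (U n ω))
          (M.obsY (t n ω) (W n ω) (U n ω) (price n ω))
          (M.obsZ (t n ω) (W n ω) (U n ω) (price n ω))
          (deltaZ (Matrix.of (U n ω)) (M.obsZ (t n ω) (W n ω) (U n ω) (price n ω))))
      (M.sigmaSq Θ π pstar (M.jacobian Θ π pstar)ᵀ) := by
  obtain ⟨ρ, hρ, C, hM⟩ := hsmooth.exists_regularOn
  have hS := asymptoticSample_of_hasLaw Θ hπ0 hπ1 hc (by linarith) hα1 hlaw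
  have hB := priceBox_mem_nhds hρ hpstar_mem
  have hstar := hcontraction pstar hpstar_mem
  have hmarket : ∀ᶠ s : (Σ n, Ω n) in whp P,
      M.IsMarketPrice (t s.1 s.2) (W s.1 s.2) (U s.1 s.2) (price s.1 s.2) :=
    eventually_whp_of_ae hprice
  have hlim := hS.tendsto_price hπ0 hπ1 hboundary hρ hM hpstar_mem hpstar hcontraction hmarket
  obtain ⟨K, hK⟩ := hS.exists_norm_price_sub_le hM hB hpstar hstar hmarket hlim
  have hΔ := hS.tendsto_deltaZ hM hB hK
  have hH := hM.isUnit_det_jacobian Θ π hB hstar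
  -- Transposing the estimate turns its limit into the Jacobian itself, which settles the first
  -- layout; the second uses `hΔ` directly.
  have hΔT := ((continuous_id.matrix_transpose).tendsto (M.jacobian Θ π pstar)ᵀ).comp hΔ
  rw [id, Matrix.transpose_transpose] at hΔT
  exact ⟨tendstoInProbability_of_tendsto_whp (hS.tendsto_sigmaHatSq hπ0 hπ1 hM hB hK hΔT hH),
    tendstoInProbability_of_tendsto_whp
      (hS.tendsto_sigmaHatSq hπ0 hπ1 hM hB hK hΔ (by rwa [Matrix.det_transpose]))⟩
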